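/- Let $d\ge 1$, $n=d+1$, $s\in(0,1)$ and $0<T\le\infty$. For $E\subset\mathbb R^{n}$ and $p\in\partial E$ put $$H_s(p,E)=\lim_{\delta\searrow 0}\,s(1-s)\int_{\mathbb R^{n}\setminus B_\delta(p)}\frac{\chi_{\mathbb R^{n}\setminus E}(q)-\chi_E(q)}{|p-q|^{n+s}}\,dq .$$ Let $u:\mathbb R^{d}\times[0,T)\to\mathbb R$ be continuous, of class $C^2$ on $\mathbb R^{d}\times(0,T)$, with $u(\cdot,0)$ of class $C^1$; let $E_t=\{(x,z)\in\mathbb R^d\times\mathbb R:\ z\le u(x,t)\}$, and suppose that $H_s(x,t):=H_s\big((x,u(x,t)),E_t\big)$ exists for all $x\in\mathbb R^d$ and $t\in[0,T)$. Put $v=\sqrt{1+|Du|^2}$. Assume that the graph evolves by fractional mean curvature, that is, $$\partial_t u=-\sqrt{1+|Du|^2}\;H_s\qquad\text{on }\mathbb R^{d}\times(0,T),$$ and that it has linear growth uniformly in time, that is, $\sup_{\mathbb R^d\times[0,T)}|Du|<\infty$. If $vH_s$ is bounded at the initial time, then $vH_s$ is bounded on $\mathbb R^d\times[0,T)$ by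 its initial bound: $$|v(x,t)\,H_s(x,t)|\le\sup_{y\in\mathbb R^d}|v(y,0)\,H_s(y,0)|\qquad\text{for all }x\in\mathbb R^d,\ t\in[0,T).$$ -/

import Mathlib

open MeasureTheory Filter Topology

noncomputable section

/-- `χ̃_E = χ_{Eᶜ} - χ_E`. -/
def signedIndicator {V : Type*} (E : Set V) (q : V) : ℝ :=
  Eᶜ.indicator 1 q - E.indicator 1 q

section Curvature

variable {V : Type*} [NormedAddCommGroup V] [InnerProductSpace ℝ V] [FiniteDimensional ℝ V]
  [MeasurableSpace V] [BorelSpace V]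

/-- `s (1 - s) ∫_{V ∖ B_δ(p)} χ̃_E(q) / |p - q|^{n + s} dq`, with `n = dim V`. -/
def truncatedFracMeanCurvature (s : ℝ) (E : Set V) (p : V) (δ : ℝ) : ℝ :=
  s * (1 - s) * ∫ q in (Metric.ball p δ)ᶜ,
    signedIndicator E q / ‖p - q‖ ^ ((Module.finrank ℝ V : ℝ) + s)

/-- The principal value that defines `H_s(p, E)` exists and equals `h`. -/
def HasFracMeanCurvature (s : ℝ) (E : Set V) (p : V) (h : ℝ) : Prop :=
  Tendsto (truncatedFracMeanCurvature s E p) (𝓝[>] 0) (𝓝 h)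

/-- The fractional mean curvature `H_s(p, E)`, the limit as `δ ↘ 0` of the truncated integrals;
it is meaningful only where `∃ h, HasFracMeanCurvature s E p h`. -/
def fracMeanCurvature (s : ℝ) (E : Set V) (p : V) : ℝ :=
  limUnder (𝓝[>] 0) (truncatedFracMeanCurvature s E p)

end Curvature

section Graph

variable {d : ℕ}

/-- `ℝ^d × ℝ` with the Euclidean structure of `ℝ^{d+1}`. -/
abbrev GraphSpace (d : ℕ) : Type := WithLp 2 (EuclideanSpace ℝ (Fin d) × ℝ)

/-- The set `{(x, z) : z ≤ f x}` below the graph of `f`. -/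
def subgraph (f : EuclideanSpace ℝ (Fin d) → ℝ) : Set (GraphSpace d) :=
  {q | q.snd ≤ f q.fst}

/-- The point `(x, f x)` of the graph of `f`. -/
def graphPoint (f : EuclideanSpace ℝ (Fin d) → ℝ) (x : EuclideanSpace ℝ (Fin d)) : GraphSpace d :=
  WithLp.toLp 2 (x, f x)

/-- `H_s` of the set below the graph of `f`, at the point of the graph over `x`. -/
def graphCurvature (s : ℝ) (f : EuclideanSpace ℝ (Fin d) → ℝ)
    (x : EuclideanSpace ℝ (Fin d)) : ℝ :=
  fracMeanCurvature s (subgraph f) (graphPoint f x)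

/-- `v = √(1 + |Df|²)`. -/
def areaFactor (f : EuclideanSpace ℝ (Fin d) → ℝ) (x : EuclideanSpace ℝ (Fin d)) : ℝ :=
  Real.sqrt (1 + ‖gradient f x‖ ^ 2)

/-- `u` is a classical solution on `[0, T)` (with `T = ∞` allowed) of the fractional mean
curvature flow of entire graphs, `∂ₜu = -√(1 + |Du|²) H_s`. The argument of `u` is `(t, x)`. -/
structure IsGraphicalFlow (s : ℝ) (T : EReal) (u : ℝ → EuclideanSpace ℝ (Fin d) → ℝ) : Prop where
  /-- `u` is continuous up to the initial time. -/
  continuousOn : ContinuousOn (fun q : ℝ × EuclideanSpace ℝ (Fin d) => u q.1 q.2)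
    {q | 0 ≤ q.1 ∧ (q.1 : EReal) < T}
  /-- `u` is of class `C²` in space and time at positive times. -/
  contDiffOn : ContDiffOn ℝ 2 (fun q : ℝ × EuclideanSpace ℝ (Fin d) => u q.1 q.2)
    {q | 0 < q.1 ∧ (q.1 : EReal) < T}
  /-- The initial surface is of class `C¹`. -/
  contDiff_zero : ContDiff ℝ 1 (u 0)
  /-- `H_s` is well defined at every point of the surface at every time, also at `t = 0`. -/
  hasCurvature : ∀ t : ℝ, 0 ≤ t → (t : EReal) < T → ∀ x,
    ∃ h, HasFracMeanCurvature s (subgraph (u t)) (graphPoint (u t) x) h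
  /-- The evolution equation. -/
  evolution : ∀ t : ℝ, 0 < t → (t : EReal) < T → ∀ x,
    HasDerivAt (fun τ => u τ x) (-(areaFactor (u t) x * graphCurvature s (u t) x)) t

end Graph

end

/-! Since `v H_s = -∂ₜu`, it suffices that `u` is Lipschitz in time with constant `M`, and this
follows from comparison alone, without differentiating `H_s`. The frozen initial graph solves the
flow up to a forcing of size `M`, so `|u(t) - u(0)| ≤ M t` (`IsGraphicalFlow.abs_sub_zero_le`). The
flow is autonomous and its time shift by `h` starts within `M h` of it, so comparison gives `|u(t +
h) - u(t)| ≤ M h` at all later times (`IsGraphicalFlow.abs_sub_le`). Difference quotients then bound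
`∂ₜu`.

The comparison principle on the noncompact domain (`IsGraphFamily.le_add_of_subsolution`) doubles
the variables. The penalty `|x - y|² / (2η)` makes paraboloids touch both graphs at a maximum, with
opening independent of `ε`; the penalty `ε √(1 + |x|²)` makes the maximum exist. The paraboloids
bound the curvatures from one side and make the singular part near the point small, without bounds
on second derivatives. Away from the point the increments of the two graphs are ordered up to `ε
|z|`. Hence the speeds are ordered up to a small error (`exists_speed_gap_lt`), which contradicts a
maximum at a positive time. Existence of the maximum needs `u - w` bounded above, which
`IsGraphicalFlow.exists_abs_sub_zero_le` supplies. -/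

open scoped ENNReal RealInnerProductSpace

/-! ### Mass of the singular kernel on thin sets around a graph. -/

section KernelEstimates

variable {d : ℕ}

theorem finrank_graphSpace : Module.finrank ℝ (GraphSpace d) = d + 1 := by
  rw [(WithLp.linearEquiv 2 ℝ (EuclideanSpace ℝ (Fin d) × ℝ)).finrank_eq]
  simp

/-- Tonelli over vertical lines: a kernel dominated by a function of the horizontal variable leaves
only the length of each section. Both mass estimates below reduce to integrals over `ℝ^d` in this
way. -/
theorem lintegral_graphSpace_le {S : Set (GraphSpace d)} (hS : MeasurableSet S)
    {k : GraphSpace d → ℝ≥0∞} {φ b : EuclideanSpace ℝ (Fin d) → ℝ≥0∞} (hφ : Measurable φ)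
    (hk : ∀ q ∈ S, k q ≤ φ q.fst) (hb : ∀ z, volume {ζ : ℝ | WithLp.toLp 2 (z, ζ) ∈ S} ≤ b z) :
    ∫⁻ q in S, k q ≤ ∫⁻ z, b z * φ z := by
  have hfst : Measurable fun q : GraphSpace d => φ q.fst :=
    hφ.comp (by fun_prop : Continuous fun q : GraphSpace d => q.fst).measurable
  have hmeas : Measurable (S.indicator fun q : GraphSpace d => φ q.fst) := hfst.indicator hS
  calc ∫⁻ q in S, k q ≤ ∫⁻ q in S, φ q.fst := setLIntegral_mono hfst hk
    _ = ∫⁻ q, S.indicator (fun q => φ q.fst) q := (lintegral_indicator hS _).symm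
    _ = ∫⁻ p : EuclideanSpace ℝ (Fin d) × ℝ,
          S.indicator (fun q => φ q.fst) (WithLp.toLp 2 p) :=
        ((WithLp.volume_preserving_toLp _ _).lintegral_comp hmeas).symm
    _ = ∫⁻ z : EuclideanSpace ℝ (Fin d), ∫⁻ ζ : ℝ,
          S.indicator (fun q => φ q.fst) (WithLp.toLp 2 (z, ζ)) := by
        rw [Measure.volume_eq_prod, lintegral_prod]
        exact (hmeas.comp (WithLp.volume_preserving_toLp _ _).measurable).aemeasurable
    _ ≤ ∫⁻ z, b z * φ z := by
        refine lintegral_mono fun z => ?_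
        have hSz : MeasurableSet {ζ : ℝ | WithLp.toLp 2 (z, ζ) ∈ S} :=
          hS.preimage ((WithLp.volume_preserving_toLp _ _).measurable.comp measurable_prodMk_left)
        calc ∫⁻ ζ : ℝ, S.indicator (fun q => φ q.fst) (WithLp.toLp 2 (z, ζ))
            = ∫⁻ ζ : ℝ, {ζ : ℝ | WithLp.toLp 2 (z, ζ) ∈ S}.indicator (fun _ => φ z) ζ := rfl
          _ = φ z * volume {ζ : ℝ | WithLp.toLp 2 (z, ζ) ∈ S} := lintegral_indicator_const hSz _
          _ ≤ b z * φ z := by rw [mul_comm]; gcongr; exact hb z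

theorem norm_fst_le_graphSpace (q : GraphSpace d) : ‖q.fst‖ ≤ ‖q‖ := by
  rw [WithLp.prod_norm_eq_of_L2]
  exact Real.le_sqrt_of_sq_le (by nlinarith [sq_nonneg ‖q.snd‖])

/-- The region where a function pinched to second order along the plane `ζ = ⟪p, z⟫` may fail to
be odd. -/
def parabolicSlab (p : EuclideanSpace ℝ (Fin d)) (C : ℝ) : Set (GraphSpace d) :=
  {q | |q.snd - ⟪p, q.fst⟫| ≤ C * ‖q.fst‖ ^ 2}

theorem measurableSet_parabolicSlab (p : EuclideanSpace ℝ (Fin d)) (C : ℝ) :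
    MeasurableSet (parabolicSlab p C) :=
  (isClosed_le (f := fun q : GraphSpace d => |q.snd - ⟪p, q.fst⟫|)
    (g := fun q : GraphSpace d => C * ‖q.fst‖ ^ 2) (by fun_prop) (by fun_prop)).measurableSet

theorem lintegral_norm_rpow_ball_lt_top {α : ℝ} (hα : -(d : ℝ) < α) :
    ∫⁻ z in Metric.ball (0 : EuclideanSpace ℝ (Fin d)) 1, ENNReal.ofReal (‖z‖ ^ α) < ∞ := by
  rcases Nat.eq_zero_or_pos d with rfl | hd
  · refine (setLIntegral_lt_top_of_le_nnreal (Metric.isBounded_ball.measure_lt_top.ne) ?_)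
    refine ⟨1, fun z _ => ?_⟩
    have hα : 0 < α := by simpa using hα
    rw [Subsingleton.elim z 0, norm_zero, Real.zero_rpow hα.ne']
    simp
  · have hfr : Module.finrank ℝ (EuclideanSpace ℝ (Fin d)) = d := by simp
    have h := integrableOn_ball_of_norm_le_rpow (E := EuclideanSpace ℝ (Fin d)) (F := ℝ) (C := 1)
      (α := -α) (r := 1) (μ := volume) (f := fun z => ‖z‖ ^ α) (by rw [hfr]; exact hd)
      (by rw [hfr]; linarith)
      (ae_of_all _ fun z => by
        rw [neg_neg, one_mul, Real.norm_of_nonneg (by positivity)])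
      (by fun_prop : Measurable fun z : EuclideanSpace ℝ (Fin d) => ‖z‖ ^ α).aestronglyMeasurable
    exact h.lintegral_lt_top

theorem one_div_norm_rpow_le_of_mem_parabolicSlab {p : EuclideanSpace ℝ (Fin d)} {C a : ℝ}
    (ha : 0 < a) {q : GraphSpace d} (hq : q ∈ parabolicSlab p C) :
    1 / ‖q‖ ^ a ≤ ‖q.fst‖ ^ (-a) := by
  by_cases hz : q.fst = 0
  -- Over `z = 0` the slab contains only the origin, where `1 / 0 ^ a` is `0` by convention.
  · have h2 : q.snd = 0 := by
      have h : |q.snd - ⟪p, q.fst⟫| ≤ C * ‖q.fst‖ ^ 2 := hq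
      simpa [hz] using h
    have hn : ‖q‖ = 0 := by rw [WithLp.prod_norm_eq_of_L2, hz, h2]; simp
    rw [hn, Real.zero_rpow ha.ne', div_zero]
    positivity
  · have hpos : 0 < ‖q.fst‖ := norm_pos_iff.2 hz
    rw [Real.rpow_neg hpos.le, ← one_div]
    exact one_div_le_one_div_of_le (by positivity)
      (Real.rpow_le_rpow hpos.le (norm_fst_le_graphSpace q) ha.le)

theorem sq_mul_rpow_le {t r a θ : ℝ} (ht : 0 ≤ t) (htr : t ≤ r) (hθ : 0 ≤ θ) :
    t ^ 2 * t ^ (-a) ≤ r ^ θ * t ^ (2 - a - θ) := by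
  rcases ht.eq_or_lt with rfl | ht
  · have : 0 ≤ r ^ θ := Real.rpow_nonneg htr _
    have h2 : (0 : ℝ) ≤ 0 ^ (2 - a - θ) := Real.rpow_nonneg le_rfl _
    simpa using mul_nonneg this h2
  · calc t ^ 2 * t ^ (-a) = t ^ θ * t ^ (2 - a - θ) := by
          rw [← Real.rpow_natCast, ← Real.rpow_add ht, ← Real.rpow_add ht]
          congr 1
          push_cast
          ring
      _ ≤ r ^ θ * t ^ (2 - a - θ) := by gcongr

/-- The singular kernel has mass `O(C r ^ θ)` on the part of the parabolic slab in the ball of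
radius `r`, uniformly in the slope. -/
theorem exists_lintegral_parabolicSlab_le (d : ℕ) {s : ℝ} (hs0 : 0 < s) (hs1 : s < 1) :
    ∃ N θ : ℝ, 0 ≤ N ∧ 0 < θ ∧ ∀ (p : EuclideanSpace ℝ (Fin d)) (C r : ℝ), 0 ≤ C → 0 < r → r ≤ 1 →
      ∫⁻ q in parabolicSlab p C ∩ Metric.ball 0 r,
        ENNReal.ofReal (1 / ‖q‖ ^ ((Module.finrank ℝ (GraphSpace d) : ℝ) + s)) ≤
          ENNReal.ofReal (C * N * r ^ θ) := by
  set a : ℝ := (Module.finrank ℝ (GraphSpace d) : ℝ) + s with ha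
  have ha' : a = d + 1 + s := by rw [ha, finrank_graphSpace]; push_cast; ring
  have ha0 : 0 < a := by rw [ha']; positivity
  -- Sections of length `2C‖z‖²` against `‖z‖ ^ (-a)`, with `a = d + 1 + s`, leave the exponent `2 -
  -- a = -d + (1 - s)`. Half of the margin `1 - s` keeps the integral finite, the other half yields
  -- the factor `r ^ θ`.
  set θ : ℝ := (1 - s) / 2 with hθ
  have hθ0 : 0 < θ := by rw [hθ]; linarith
  have hfin := lintegral_norm_rpow_ball_lt_top (d := d) (α := 2 - a - θ) (by rw [ha', hθ]; linarith)
  set N₀ := ∫⁻ z in Metric.ball (0 : EuclideanSpace ℝ (Fin d)) 1,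
    ENNReal.ofReal (‖z‖ ^ (2 - a - θ)) with hN₀
  refine ⟨2 * N₀.toReal, θ, by positivity, hθ0, fun p C r hC hr hr1 => ?_⟩
  calc ∫⁻ q in parabolicSlab p C ∩ Metric.ball 0 r, ENNReal.ofReal (1 / ‖q‖ ^ a)
      ≤ ∫⁻ z : EuclideanSpace ℝ (Fin d), ((Metric.ball 0 r).indicator
          (fun z => ENNReal.ofReal (2 * C * ‖z‖ ^ 2)) z) * ENNReal.ofReal (‖z‖ ^ (-a)) := by
        refine lintegral_graphSpace_le
          ((measurableSet_parabolicSlab p C).inter measurableSet_ball) (by fun_prop)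
          (fun q hq => ENNReal.ofReal_le_ofReal
            (one_div_norm_rpow_le_of_mem_parabolicSlab ha0 hq.1)) fun z => ?_
        by_cases hz : z ∈ Metric.ball (0 : EuclideanSpace ℝ (Fin d)) r
        · rw [Set.indicator_of_mem hz]
          refine (measure_mono (t := Set.Icc (⟪p, z⟫ - C * ‖z‖ ^ 2) (⟪p, z⟫ + C * ‖z‖ ^ 2))
            fun ζ hζ => ?_).trans ?_
          · have h : |ζ - ⟪p, z⟫| ≤ C * ‖z‖ ^ 2 := hζ.1
            rw [abs_le] at h
            exact ⟨by linarith [h.1], by linarith [h.2]⟩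
          · rw [Real.volume_Icc]
            exact ENNReal.ofReal_le_ofReal (by linarith)
        · rw [Set.indicator_of_notMem hz]
          refine (measure_mono_null (t := ∅) (fun ζ hζ => hz ?_) measure_empty).le
          have h : ‖(WithLp.toLp 2 (z, ζ) : GraphSpace d)‖ < r := mem_ball_zero_iff.1 hζ.2
          exact mem_ball_zero_iff.2
            ((norm_fst_le_graphSpace (WithLp.toLp 2 (z, ζ) : GraphSpace d)).trans_lt h)
    _ ≤ ∫⁻ z : EuclideanSpace ℝ (Fin d), (Metric.ball 0 1).indicator
          (fun z => ENNReal.ofReal (2 * C * r ^ θ) * ENNReal.ofReal (‖z‖ ^ (2 - a - θ))) z := by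
        refine lintegral_mono fun z => ?_
        by_cases hz : z ∈ Metric.ball (0 : EuclideanSpace ℝ (Fin d)) r
        · have hz' := mem_ball_zero_iff.1 hz
          rw [Set.indicator_of_mem hz, Set.indicator_of_mem (Metric.ball_subset_ball hr1 hz),
            ← ENNReal.ofReal_mul (by positivity), ← ENNReal.ofReal_mul (by positivity)]
          refine ENNReal.ofReal_le_ofReal ?_
          have := sq_mul_rpow_le (a := a) (norm_nonneg z) hz'.le hθ0.le
          calc 2 * C * ‖z‖ ^ 2 * ‖z‖ ^ (-a) = 2 * C * (‖z‖ ^ 2 * ‖z‖ ^ (-a)) := by ring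
            _ ≤ 2 * C * (r ^ θ * ‖z‖ ^ (2 - a - θ)) := by gcongr
            _ = _ := by ring
        · rw [Set.indicator_of_notMem hz, zero_mul]
          exact zero_le
    _ = ENNReal.ofReal (2 * C * r ^ θ) * N₀ := by
        rw [lintegral_indicator measurableSet_ball, lintegral_const_mul' _ _ ENNReal.ofReal_ne_top]
    _ = ENNReal.ofReal (C * (2 * N₀.toReal) * r ^ θ) := by
        rw [← ENNReal.ofReal_toReal hfin.ne, ← ENNReal.ofReal_mul (by positivity)]
        simp only [ENNReal.toReal_ofReal ENNReal.toReal_nonneg]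
        congr 1
        ring

theorem one_div_rpow_le_mul_one_add_rpow_neg {r t a : ℝ} (hr : 0 < r) (ht : r ≤ t) (ha : 0 < a) :
    1 / t ^ a ≤ ((1 + r) / r) ^ a * (1 + t) ^ (-a) := by
  have ht0 : 0 < t := hr.trans_le ht
  have h : (1 + r) / r * t ≥ 1 + t := by
    rw [ge_iff_le, div_mul_eq_mul_div, le_div_iff₀ hr]
    nlinarith
  rw [Real.rpow_neg (by positivity), ← div_eq_mul_inv, div_le_div_iff₀ (by positivity)
    (by positivity), one_mul, ← Real.mul_rpow (by positivity) ht0.le]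
  exact Real.rpow_le_rpow (by positivity) h ha.le

theorem integrableOn_kernel_compl_ball {s r : ℝ} (hs0 : 0 < s) (hr : 0 < r) :
    IntegrableOn (fun q : GraphSpace d =>
      1 / ‖q‖ ^ ((Module.finrank ℝ (GraphSpace d) : ℝ) + s)) (Metric.ball 0 r)ᶜ := by
  set a : ℝ := (Module.finrank ℝ (GraphSpace d) : ℝ) + s with ha
  have ha0 : 0 < a := by positivity
  refine Integrable.mono'
    (((integrable_one_add_norm (E := GraphSpace d) (μ := volume) (r := a)
      (by rw [ha]; linarith)).const_mul (((1 + r) / r) ^ a)).integrableOn)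
    (by fun_prop : Measurable fun q : GraphSpace d => 1 / ‖q‖ ^ a).aestronglyMeasurable ?_
  filter_upwards [ae_restrict_mem measurableSet_ball.compl] with q hq
  rw [Real.norm_of_nonneg (by positivity)]
  exact one_div_rpow_le_mul_one_add_rpow_neg hr (by simpa using hq) ha0

/-- Outside a ball, the singular kernel has mass `O(ε)` on a set whose vertical sections over `z`
have length at most `ε ‖z‖`. -/
theorem exists_lintegral_thin_le (d : ℕ) {s r : ℝ} (hs0 : 0 < s) (hr : 0 < r) :
    ∃ N : ℝ, 0 ≤ N ∧ ∀ (S : Set (GraphSpace d)) (ε : ℝ), MeasurableSet S → 0 ≤ ε →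
      (∀ z, volume {ζ : ℝ | WithLp.toLp 2 (z, ζ) ∈ S} ≤ ENNReal.ofReal (ε * ‖z‖)) →
      ∫⁻ q in S ∩ (Metric.ball 0 r)ᶜ,
        ENNReal.ofReal (1 / ‖q‖ ^ ((Module.finrank ℝ (GraphSpace d) : ℝ) + s)) ≤
          ENNReal.ofReal (ε * N) := by
  set a : ℝ := (Module.finrank ℝ (GraphSpace d) : ℝ) + s with ha
  have ha' : a = d + 1 + s := by rw [ha, finrank_graphSpace]; push_cast; ring
  have ha0 : 0 < a := by positivity
  -- Linearly growing sections cost one power of decay: `a - 1 = d + s` still exceeds `d` because `s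
  -- > 0`.
  have hint := (integrable_one_add_norm (E := EuclideanSpace ℝ (Fin d)) (μ := volume)
    (r := a - 1) (by rw [ha']; simp; linarith))
  have hfin := hint.lintegral_lt_top
  set N₀ := ∫⁻ z : EuclideanSpace ℝ (Fin d), ENNReal.ofReal ((1 + ‖z‖) ^ (-(a - 1))) with hN₀
  set c : ℝ := ((1 + r) / r) ^ a with hc
  have hc0 : 0 ≤ c := by positivity
  refine ⟨c * N₀.toReal, by positivity, fun S ε hS hε hb => ?_⟩
  calc ∫⁻ q in S ∩ (Metric.ball 0 r)ᶜ, ENNReal.ofReal (1 / ‖q‖ ^ a)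
      ≤ ∫⁻ z : EuclideanSpace ℝ (Fin d), ENNReal.ofReal (ε * ‖z‖) *
          ENNReal.ofReal (c * (1 + ‖z‖) ^ (-a)) := by
        refine lintegral_graphSpace_le (hS.inter measurableSet_ball.compl) (by fun_prop)
          (fun q hq => ENNReal.ofReal_le_ofReal ?_)
          fun z => (measure_mono fun ζ hζ => hζ.1).trans (hb z)
        refine (one_div_rpow_le_mul_one_add_rpow_neg hr (by simpa using hq.2) ha0).trans ?_
        have h1 := norm_fst_le_graphSpace q
        gcongr ?_ * ?_
        exact Real.rpow_le_rpow_of_nonpos (by positivity) (by linarith) (by linarith)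
    _ ≤ ∫⁻ z : EuclideanSpace ℝ (Fin d), ENNReal.ofReal (ε * c) *
          ENNReal.ofReal ((1 + ‖z‖) ^ (-(a - 1))) := by
        refine lintegral_mono fun z => ?_
        rw [← ENNReal.ofReal_mul (by positivity), ← ENNReal.ofReal_mul (by positivity)]
        refine ENNReal.ofReal_le_ofReal ?_
        have h1 : (0 : ℝ) < 1 + ‖z‖ := by positivity
        have h2 : (1 + ‖z‖) ^ (-(a - 1)) = (1 + ‖z‖) * (1 + ‖z‖) ^ (-a) := by
          rw [show -(a - 1) = 1 + -a by ring, Real.rpow_add h1, Real.rpow_one]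
        rw [h2]
        calc ε * ‖z‖ * (c * (1 + ‖z‖) ^ (-a)) = ε * c * (‖z‖ * (1 + ‖z‖) ^ (-a)) := by ring
          _ ≤ _ := by gcongr; linarith
    _ = ENNReal.ofReal (ε * c) * N₀ := lintegral_const_mul' _ _ ENNReal.ofReal_ne_top
    _ = ENNReal.ofReal (ε * (c * N₀.toReal)) := by
        rw [← ENNReal.ofReal_toReal hfin.ne, ← ENNReal.ofReal_mul (by positivity)]
        simp only [ENNReal.toReal_ofReal ENNReal.toReal_nonneg]
        congr 1
        ring

end KernelEstimates

/-! ### One-sided bounds and comparison for the fractional mean curvature of graphs. -/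

section Curvature

variable {d : ℕ}

theorem signedIndicator_of_mem {V : Type*} {E : Set V} {q : V} (h : q ∈ E) :
    signedIndicator E q = -1 := by
  simp [signedIndicator, h]

theorem signedIndicator_of_notMem {V : Type*} {E : Set V} {q : V} (h : q ∉ E) :
    signedIndicator E q = 1 := by
  simp [signedIndicator, h]

theorem abs_signedIndicator {V : Type*} (E : Set V) (q : V) : |signedIndicator E q| = 1 := by
  by_cases h : q ∈ E
  · simp [signedIndicator_of_mem h]
  · simp [signedIndicator_of_notMem h]

theorem measurable_signedIndicator {V : Type*} [MeasurableSpace V] {E : Set V}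
    (hE : MeasurableSet E) : Measurable (signedIndicator E) :=
  (measurable_one.indicator hE.compl).sub (measurable_one.indicator hE)

theorem truncatedFracMeanCurvature_eq_integral_translate (s : ℝ) (E : Set (GraphSpace d))
    (p : GraphSpace d) (δ : ℝ) :
    truncatedFracMeanCurvature s E p δ = s * (1 - s) * ∫ w in (Metric.ball 0 δ)ᶜ,
      signedIndicator E (p + w) / ‖w‖ ^ ((Module.finrank ℝ (GraphSpace d) : ℝ) + s) := by
  have h := (measurePreserving_add_left (volume : Measure (GraphSpace d)) p).setIntegral_preimage_emb
    (MeasurableEquiv.addLeft p).measurableEmbedding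
    (fun q => signedIndicator E q / ‖p - q‖ ^ ((Module.finrank ℝ (GraphSpace d) : ℝ) + s))
    (Metric.ball p δ)ᶜ
  have hpre : (fun w => p + w) ⁻¹' (Metric.ball p δ)ᶜ = (Metric.ball 0 δ)ᶜ := by
    ext w; simp
  rw [hpre] at h
  rw [truncatedFracMeanCurvature, ← h]
  simp

/-- Integrability of a bounded function against the kernel, away from the singularity. -/
theorem integrableOn_div_kernel {s r : ℝ} (hs0 : 0 < s) (hr : 0 < r) {g : GraphSpace d → ℝ}
    (hg : Measurable g) (hg1 : ∀ q, |g q| ≤ 1) :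
    IntegrableOn (fun q : GraphSpace d =>
      g q / ‖q‖ ^ ((Module.finrank ℝ (GraphSpace d) : ℝ) + s)) (Metric.ball 0 r)ᶜ := by
  refine Integrable.mono' (integrableOn_kernel_compl_ball hs0 hr)
    (by fun_prop : Measurable _).aestronglyMeasurable (ae_of_all _ fun q => ?_)
  rw [norm_div, Real.norm_eq_abs, Real.norm_of_nonneg (by positivity)]
  gcongr
  exact hg1 q

/-- A bounded function whose even part is nonnegative off `R` has its integral against the kernel
over an annulus bounded below by minus the kernel mass of `R`. -/
theorem neg_le_integral_annulus {s δ r γ : ℝ} (hs0 : 0 < s) (hδ : 0 < δ)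
    {g : GraphSpace d → ℝ} (hg : Measurable g) (hg1 : ∀ q, |g q| ≤ 1) {R : Set (GraphSpace d)}
    (hR : MeasurableSet R) (hodd : ∀ q ∉ R, 0 ≤ g q + g (-q)) (hγ0 : 0 ≤ γ)
    (hγ : ∫⁻ q in R ∩ Metric.ball 0 r,
      ENNReal.ofReal (1 / ‖q‖ ^ ((Module.finrank ℝ (GraphSpace d) : ℝ) + s)) ≤
        ENNReal.ofReal γ) :
    -γ ≤ ∫ q in (Metric.ball 0 δ)ᶜ ∩ Metric.ball 0 r,
      g q / ‖q‖ ^ ((Module.finrank ℝ (GraphSpace d) : ℝ) + s) := by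
  set a : ℝ := (Module.finrank ℝ (GraphSpace d) : ℝ) + s with ha
  set A : Set (GraphSpace d) := (Metric.ball 0 δ)ᶜ ∩ Metric.ball 0 r with hA
  have hAm : MeasurableSet A := measurableSet_ball.compl.inter measurableSet_ball
  have hk : IntegrableOn (fun q : GraphSpace d => 1 / ‖q‖ ^ a) A :=
    (integrableOn_kernel_compl_ball hs0 hδ).mono_set Set.inter_subset_left
  have hgi : IntegrableOn (fun q => g q / ‖q‖ ^ a) A :=
    (integrableOn_div_kernel hs0 hδ hg hg1).mono_set Set.inter_subset_left
  have hgi' : IntegrableOn (fun q => g (-q) / ‖q‖ ^ a) A :=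
    (integrableOn_div_kernel hs0 hδ (hg.comp measurable_neg) fun q => hg1 (-q)).mono_set
      Set.inter_subset_left
  -- The annulus is symmetric, so twice the integral of `g` is the integral of `g q + g (-q)`: at
  -- least `-2` on `R`, nonnegative off it.
  have hneg : ∫ q in A, g (-q) / ‖q‖ ^ a = ∫ q in A, g q / ‖q‖ ^ a := by
    have h := (Measure.measurePreserving_neg
      (volume : Measure (GraphSpace d))).setIntegral_preimage_emb
      (MeasurableEquiv.neg (GraphSpace d)).measurableEmbedding (fun q => g q / ‖q‖ ^ a) A
    have hpre : Neg.neg ⁻¹' A = A := by ext w; simp [hA]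
    rw [hpre] at h
    simpa using h
  have hmass : ∫ q in A, R.indicator (fun q => 1 / ‖q‖ ^ a) q ≤ γ := by
    rw [setIntegral_indicator hR, integral_eq_lintegral_of_nonneg_ae
      (ae_of_all _ fun q => by positivity)
      (by fun_prop : Measurable fun q : GraphSpace d => 1 / ‖q‖ ^ a).aestronglyMeasurable]
    refine ENNReal.toReal_le_of_le_ofReal hγ0 (le_trans (lintegral_mono_set ?_) hγ)
    exact fun q hq => ⟨hq.2, hq.1.2⟩
  have hle : ∫ q in A, -(2 * R.indicator (fun q => 1 / ‖q‖ ^ a) q) ≤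
      ∫ q in A, (g q / ‖q‖ ^ a + g (-q) / ‖q‖ ^ a) := by
    refine integral_mono ((hk.indicator hR).const_mul 2).neg (hgi.add hgi') fun q => ?_
    simp only
    rw [← add_div]
    by_cases hq : q ∈ R
    · rw [Set.indicator_of_mem hq, mul_one_div, ← neg_div]
      gcongr
      linarith [neg_le_of_abs_le (hg1 q), neg_le_of_abs_le (hg1 (-q))]
    · rw [Set.indicator_of_notMem hq, mul_zero, neg_zero]
      exact div_nonneg (hodd q hq) (by positivity)
  rw [integral_add hgi hgi', hneg, integral_neg, integral_const_mul] at hle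
  linarith

theorem measurableSet_subgraph {f : EuclideanSpace ℝ (Fin d) → ℝ} (hf : Continuous f) :
    MeasurableSet (subgraph f) :=
  (isClosed_le (f := fun q : GraphSpace d => q.snd) (g := fun q : GraphSpace d => f q.fst)
    (by fun_prop) (by fun_prop)).measurableSet

theorem measurable_signedIndicator_translate {f : EuclideanSpace ℝ (Fin d) → ℝ}
    (hf : Continuous f) (x : EuclideanSpace ℝ (Fin d)) :
    Measurable fun q => signedIndicator (subgraph f) (graphPoint f x + q) :=
  (measurable_signedIndicator (measurableSet_subgraph hf)).comp (measurable_const_add _)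

theorem graphPoint_add_mem_subgraph {f : EuclideanSpace ℝ (Fin d) → ℝ}
    {x : EuclideanSpace ℝ (Fin d)} {q : GraphSpace d} :
    graphPoint f x + q ∈ subgraph f ↔ f x + q.snd ≤ f (x + q.fst) :=
  Iff.rfl

theorem truncatedFracMeanCurvature_sub {s δ r : ℝ} (hs0 : 0 < s) (hδ : 0 < δ) (hδr : δ ≤ r)
    {f : EuclideanSpace ℝ (Fin d) → ℝ} (hf : Continuous f) (x : EuclideanSpace ℝ (Fin d)) :
    truncatedFracMeanCurvature s (subgraph f) (graphPoint f x) δ =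
      s * (1 - s) * (∫ q in (Metric.ball 0 δ)ᶜ ∩ Metric.ball 0 r,
        signedIndicator (subgraph f) (graphPoint f x + q) /
          ‖q‖ ^ ((Module.finrank ℝ (GraphSpace d) : ℝ) + s)) +
      truncatedFracMeanCurvature s (subgraph f) (graphPoint f x) r := by
  have hi := integrableOn_div_kernel hs0 hδ (measurable_signedIndicator_translate hf x)
    fun q => (abs_signedIndicator (subgraph f) _).le
  rw [truncatedFracMeanCurvature_eq_integral_translate,
    truncatedFracMeanCurvature_eq_integral_translate, ← mul_add]
  congr 1
  have hsplit : (Metric.ball (0 : GraphSpace d) δ)ᶜ =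
      ((Metric.ball 0 δ)ᶜ ∩ Metric.ball 0 r) ∪ (Metric.ball 0 r)ᶜ := by
    ext q
    simp only [Set.mem_compl_iff, Metric.mem_ball, Set.mem_union, Set.mem_inter_iff, dist_zero_right]
    constructor
    · intro h; by_cases h' : ‖q‖ < r
      · exact Or.inl ⟨h, h'⟩
      · exact Or.inr h'
    · rintro (h | h)
      · exact h.1
      · linarith
  conv_lhs => rw [hsplit]
  refine setIntegral_union ?_ measurableSet_ball.compl (hi.mono_set Set.inter_subset_left)
    (hi.mono_set (Set.compl_subset_compl.2 (Metric.ball_subset_ball hδr)))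
  exact Set.disjoint_left.2 fun q hq hq' => hq' hq.2

/-- Touching by a paraboloid from above (below) at a point bounds the curvature there from below
(above) by the truncated curvature, with an error that depends only on the opening of the
paraboloid. -/
theorem exists_curvature_bounds_of_paraboloid (d : ℕ) {s : ℝ} (hs0 : 0 < s) (hs1 : s < 1) :
    ∃ N θ : ℝ, 0 ≤ N ∧ 0 < θ ∧ ∀ (f : EuclideanSpace ℝ (Fin d) → ℝ)
      (x p : EuclideanSpace ℝ (Fin d)) (C r h : ℝ), Continuous f → 0 ≤ C → 0 < r → r ≤ 1 →
      HasFracMeanCurvature s (subgraph f) (graphPoint f x) h →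
      ((∀ z, f (x + z) ≤ f x + ⟪p, z⟫ + C * ‖z‖ ^ 2) →
        truncatedFracMeanCurvature s (subgraph f) (graphPoint f x) r - C * N * r ^ θ ≤ h) ∧
      ((∀ z, f x + ⟪p, z⟫ - C * ‖z‖ ^ 2 ≤ f (x + z)) →
        h ≤ truncatedFracMeanCurvature s (subgraph f) (graphPoint f x) r + C * N * r ^ θ) := by
  obtain ⟨N, θ, hN, hθ, hslab⟩ := exists_lintegral_parabolicSlab_le d hs0 hs1
  refine ⟨N, θ, hN, hθ, fun f x p C r h hf hC hr hr1 hh => ?_⟩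
  have hc0 : 0 ≤ s * (1 - s) := mul_nonneg hs0.le (by linarith)
  have hc1 : s * (1 - s) ≤ 1 := by nlinarith
  have hγ : 0 ≤ C * N * r ^ θ := by positivity
  have hev : ∀ᶠ δ in 𝓝[>] (0 : ℝ), 0 < δ ∧ δ ≤ r := by
    filter_upwards [Ioo_mem_nhdsGT hr] with δ hδ using ⟨hδ.1, hδ.2.le⟩
  have hmeas := measurable_signedIndicator_translate hf x
  have habs := fun q => (abs_signedIndicator (subgraph f) (graphPoint f x + q)).le
  have hR := measurableSet_parabolicSlab p C
  constructor
  · intro hup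
    refine ge_of_tendsto hh ?_
    filter_upwards [hev] with δ hδ
    rw [truncatedFracMeanCurvature_sub hs0 hδ.1 hδ.2 hf]
    have hlow := neg_le_integral_annulus hs0 hδ.1 hmeas habs hR (fun q hq => ?_) hγ
      (hslab p C r hC hr hr1)
    · nlinarith
    · have hq' : C * ‖q.fst‖ ^ 2 < |q.snd - ⟪p, q.fst⟫| := not_le.1 hq
      have h1 := neg_le_of_abs_le (habs q)
      have h2 := neg_le_of_abs_le (habs (-q))
      -- Off the slab, `q` or `-q` lies above the paraboloid, hence outside the subgraph. Its sign
      -- `+1` offsets the other sign, which is at least `-1`.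
      rcases lt_abs.1 hq' with hq' | hq'
      · have : signedIndicator (subgraph f) (graphPoint f x + q) = 1 :=
          signedIndicator_of_notMem fun hm => by
            have := graphPoint_add_mem_subgraph.1 hm
            linarith [hup q.fst]
        linarith
      · have : signedIndicator (subgraph f) (graphPoint f x + -q) = 1 :=
          signedIndicator_of_notMem fun hm => by
            have := graphPoint_add_mem_subgraph.1 hm
            have h3 := hup (-q.fst)
            rw [inner_neg_right, norm_neg] at h3
            simp only [WithLp.neg_snd, WithLp.neg_fst] at this
            linarith
        linarith
  · intro hlo
    refine le_of_tendsto hh ?_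
    filter_upwards [hev] with δ hδ
    rw [truncatedFracMeanCurvature_sub hs0 hδ.1 hδ.2 hf]
    have hlow := neg_le_integral_annulus hs0 hδ.1 hmeas.neg
      (fun q => (abs_neg _).trans_le (habs q)) hR (fun q hq => ?_) hγ (hslab p C r hC hr hr1)
    · simp only [Pi.neg_apply, neg_div, integral_neg] at hlow
      nlinarith
    · have hq' : C * ‖q.fst‖ ^ 2 < |q.snd - ⟪p, q.fst⟫| := not_le.1 hq
      have h1 := le_of_abs_le (habs q)
      have h2 := le_of_abs_le (habs (-q))
      simp only [Pi.neg_apply]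
      rcases lt_abs.1 hq' with hq' | hq'
      · have : signedIndicator (subgraph f) (graphPoint f x + -q) = -1 := by
          refine signedIndicator_of_mem (graphPoint_add_mem_subgraph.2 ?_)
          have h3 := hlo (-q.fst)
          rw [inner_neg_right, norm_neg] at h3
          simp only [WithLp.neg_snd, WithLp.neg_fst]
          linarith
        linarith
      · have : signedIndicator (subgraph f) (graphPoint f x + q) = -1 := by
          refine signedIndicator_of_mem (graphPoint_add_mem_subgraph.2 ?_)
          linarith [hlo q.fst]
        linarith

/-- The kernel has finite mass off the unit ball, so the bound does not see the function. -/
theorem exists_abs_truncatedFracMeanCurvature_le (d : ℕ) {s : ℝ} (hs0 : 0 < s) (hs1 : s < 1) :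
    ∃ B : ℝ, 0 ≤ B ∧ ∀ (f : EuclideanSpace ℝ (Fin d) → ℝ) (x : EuclideanSpace ℝ (Fin d)),
      |truncatedFracMeanCurvature s (subgraph f) (graphPoint f x) 1| ≤ B := by
  have hc0 : 0 ≤ s * (1 - s) := mul_nonneg hs0.le (by linarith)
  refine ⟨s * (1 - s) * ∫ q in (Metric.ball (0 : GraphSpace d) 1)ᶜ,
    1 / ‖q‖ ^ ((Module.finrank ℝ (GraphSpace d) : ℝ) + s),
    mul_nonneg hc0 (integral_nonneg fun q => by positivity), fun f x => ?_⟩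
  rw [truncatedFracMeanCurvature_eq_integral_translate, abs_mul, abs_of_nonneg hc0]
  refine mul_le_mul_of_nonneg_left ?_ hc0
  rw [← Real.norm_eq_abs]
  refine norm_integral_le_of_norm_le (integrableOn_kernel_compl_ball hs0 one_pos)
    (ae_of_all _ fun q => ?_)
  rw [norm_div, Real.norm_eq_abs, abs_signedIndicator, Real.norm_of_nonneg (by positivity)]

/-- Truncated curvatures are ordered, up to `O(ε)`, when the increments of the functions are
ordered up to `ε ‖z‖`. -/
theorem exists_truncatedFracMeanCurvature_le (d : ℕ) {s r : ℝ} (hs0 : 0 < s) (hs1 : s < 1)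
    (hr : 0 < r) :
    ∃ N : ℝ, 0 ≤ N ∧ ∀ (f g : EuclideanSpace ℝ (Fin d) → ℝ) (x y : EuclideanSpace ℝ (Fin d))
      (ε : ℝ), Continuous f → Continuous g → 0 ≤ ε →
      (∀ z, f (x + z) - f x ≤ g (y + z) - g y + ε * ‖z‖) →
      truncatedFracMeanCurvature s (subgraph g) (graphPoint g y) r ≤
        truncatedFracMeanCurvature s (subgraph f) (graphPoint f x) r + ε * N := by
  obtain ⟨N, hN, hthin⟩ := exists_lintegral_thin_le d hs0 hr
  refine ⟨2 * N, by positivity, fun f g x y ε hf hg hε hfg => ?_⟩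
  have hc0 : 0 ≤ s * (1 - s) := mul_nonneg hs0.le (by linarith)
  have hc1 : s * (1 - s) ≤ 1 := by nlinarith
  set a : ℝ := (Module.finrank ℝ (GraphSpace d) : ℝ) + s with ha
  -- Only points of the translated subgraph of `f` that miss the translated subgraph of `g` have the
  -- wrong order of signs.
  set S : Set (GraphSpace d) := {q | g (y + q.fst) - g y < q.snd ∧ q.snd ≤ f (x + q.fst) - f x}
    with hS
  have hSm : MeasurableSet S :=
    (isOpen_lt (f := fun q : GraphSpace d => g (y + q.fst) - g y)
      (g := fun q : GraphSpace d => q.snd) (by fun_prop) (by fun_prop)).measurableSet.inter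
    (isClosed_le (f := fun q : GraphSpace d => q.snd)
      (g := fun q : GraphSpace d => f (x + q.fst) - f x)
      (by fun_prop) (by fun_prop)).measurableSet
  have hfi := integrableOn_div_kernel hs0 hr (measurable_signedIndicator_translate hf x)
    fun q => (abs_signedIndicator (subgraph f) _).le
  have hgi := integrableOn_div_kernel hs0 hr (measurable_signedIndicator_translate hg y)
    fun q => (abs_signedIndicator (subgraph g) _).le
  have hk := integrableOn_kernel_compl_ball (d := d) hs0 hr
  have hmass : ∫ q in (Metric.ball (0 : GraphSpace d) r)ᶜ, S.indicator (fun q => 1 / ‖q‖ ^ a) q ≤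
      ε * N := by
    rw [setIntegral_indicator hSm, integral_eq_lintegral_of_nonneg_ae
      (ae_of_all _ fun q => by positivity)
      (by fun_prop : Measurable fun q : GraphSpace d => 1 / ‖q‖ ^ a).aestronglyMeasurable,
      Set.inter_comm]
    refine ENNReal.toReal_le_of_le_ofReal (by positivity) (hthin S ε hSm hε fun z => ?_)
    refine (measure_mono (t := Set.Icc (g (y + z) - g y) (f (x + z) - f x))
      fun ζ hζ => ⟨hζ.1.le, hζ.2⟩).trans ?_
    rw [Real.volume_Icc]
    exact ENNReal.ofReal_le_ofReal (by linarith [hfg z])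
  have hle : ∫ q in (Metric.ball (0 : GraphSpace d) r)ᶜ,
      signedIndicator (subgraph g) (graphPoint g y + q) / ‖q‖ ^ a ≤
      ∫ q in (Metric.ball (0 : GraphSpace d) r)ᶜ,
        (signedIndicator (subgraph f) (graphPoint f x + q) / ‖q‖ ^ a +
          2 * S.indicator (fun q => 1 / ‖q‖ ^ a) q) := by
    refine integral_mono hgi (hfi.add ((hk.indicator hSm).const_mul 2)) fun q => ?_
    simp only
    have hf1 := abs_le.1 (abs_signedIndicator (subgraph f) (graphPoint f x + q)).le
    have hg1 := abs_le.1 (abs_signedIndicator (subgraph g) (graphPoint g y + q)).le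
    by_cases hq : q ∈ S
    · rw [Set.indicator_of_mem hq, mul_one_div, ← add_div]
      gcongr
      linarith
    · rw [Set.indicator_of_notMem hq, mul_zero, add_zero]
      gcongr
      by_cases hgq : graphPoint g y + q ∈ subgraph g
      · rw [signedIndicator_of_mem hgq]; linarith
      · by_cases hfq : graphPoint f x + q ∈ subgraph f
        · refine absurd ⟨?_, ?_⟩ hq
          · have := mt graphPoint_add_mem_subgraph.2 hgq
            linarith
          · have := graphPoint_add_mem_subgraph.1 hfq
            linarith
        · rw [signedIndicator_of_notMem hfq]; linarith
  rw [integral_add hfi ((hk.indicator hSm).const_mul 2), integral_const_mul] at hle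
  rw [truncatedFracMeanCurvature_eq_integral_translate,
    truncatedFracMeanCurvature_eq_integral_translate]
  have := mul_le_mul_of_nonneg_left hle hc0
  nlinarith [mul_nonneg hε hN]

theorem HasFracMeanCurvature.eq_graphCurvature {s h : ℝ} {f : EuclideanSpace ℝ (Fin d) → ℝ}
    {x : EuclideanSpace ℝ (Fin d)}
    (hh : HasFracMeanCurvature s (subgraph f) (graphPoint f x) h) : graphCurvature s f x = h :=
  hh.limUnder_eq

end Curvature

/-! ### A smooth coercive penalty with slope and second derivatives at most one. -/

section Bracket

variable {X : Type*} [NormedAddCommGroup X]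

/-- The bracket `√(1 + |x|²)`. -/
noncomputable def bracket (x : X) : ℝ := Real.sqrt (1 + ‖x‖ ^ 2)

theorem bracket_sq (x : X) : bracket x ^ 2 = 1 + ‖x‖ ^ 2 := Real.sq_sqrt (by positivity)

theorem one_le_bracket (x : X) : 1 ≤ bracket x :=
  Real.one_le_sqrt.2 (by linarith [sq_nonneg ‖x‖])

theorem bracket_pos (x : X) : 0 < bracket x := one_pos.trans_le (one_le_bracket x)

theorem norm_le_bracket (x : X) : ‖x‖ ≤ bracket x :=
  Real.le_sqrt_of_sq_le (by linarith)

theorem bracket_zero : bracket (0 : X) = 1 := by simp [bracket]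

@[fun_prop]
theorem continuous_bracket : Continuous (bracket : X → ℝ) := by
  unfold bracket; fun_prop

theorem bracket_le_of_norm_le {x : X} {L : ℝ} (h : ‖x‖ ≤ L) : bracket x ≤ Real.sqrt (1 + L ^ 2) := by
  unfold bracket; gcongr

theorem bracket_add_le_norm (x z : X) : bracket (x + z) ≤ bracket x + ‖z‖ := by
  refine Real.sqrt_le_iff.2 ⟨by linarith [bracket_pos x, norm_nonneg z], ?_⟩
  have h := pow_le_pow_left₀ (norm_nonneg _) (norm_add_le x z) 2
  nlinarith [bracket_sq x, mul_le_mul_of_nonneg_right (norm_le_bracket x) (norm_nonneg z)]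

theorem norm_inv_bracket_smul_le [NormedSpace ℝ X] (x : X) : ‖(bracket x)⁻¹ • x‖ ≤ 1 := by
  rw [norm_smul, norm_inv, Real.norm_of_nonneg (bracket_pos x).le, inv_mul_le_iff₀ (bracket_pos x),
    mul_one]
  exact norm_le_bracket x

/-- Expand `bracket (x + z) ^ 2` and apply `2ab ≤ a² + b²` with `a = bracket (x + z)`, `b = bracket
x`. The paraboloid is global, as the curvature estimates require. -/
theorem bracket_add_le [InnerProductSpace ℝ X] (x z : X) :
    bracket (x + z) ≤ bracket x + ⟪(bracket x)⁻¹ • x, z⟫ + 1 / 2 * ‖z‖ ^ 2 := by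
  have hb := bracket_pos x
  have h1 : ‖z‖ ^ 2 / bracket x ≤ ‖z‖ ^ 2 := div_le_self (by positivity) (one_le_bracket x)
  have h2 : bracket (x + z) ^ 2 = bracket x ^ 2 + 2 * ⟪x, z⟫ + ‖z‖ ^ 2 := by
    rw [bracket_sq, bracket_sq, norm_add_sq_real]; ring
  have h3 : bracket (x + z) ≤ bracket x + ⟪x, z⟫ / bracket x + ‖z‖ ^ 2 / bracket x / 2 := by
    have h4 : bracket (x + z) * (2 * bracket x) ≤ bracket (x + z) ^ 2 + bracket x ^ 2 := by
      nlinarith [sq_nonneg (bracket (x + z) - bracket x)]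
    have h5 : bracket x + ⟪x, z⟫ / bracket x + ‖z‖ ^ 2 / bracket x / 2 =
        (bracket (x + z) ^ 2 + bracket x ^ 2) / (2 * bracket x) := by
      rw [h2]; field_simp; ring
    rw [h5, le_div_iff₀ (by positivity)]
    exact h4
  rw [real_inner_smul_left, inv_mul_eq_div]
  linarith

end Bracket

/-! ### Existence of maxima and their first-order condition in time. -/

section Maximum

theorem exists_max_of_coercive {X : Type*} [NormedAddCommGroup X] [ProperSpace X]
    {Φ : ℝ × X → ℝ} {T R : ℝ} (hT : 0 ≤ T) (hc : ContinuousOn Φ (Set.Icc 0 T ×ˢ Set.univ))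
    (hR : ∀ t ∈ Set.Icc 0 T, ∀ x, R < ‖x‖ → Φ (t, x) ≤ Φ (0, 0)) :
    ∃ t ∈ Set.Icc 0 T, ∃ x, ∀ t' ∈ Set.Icc 0 T, ∀ x', Φ (t', x') ≤ Φ (t, x) := by
  have h0 : (0 : ℝ) ∈ Set.Icc 0 T := ⟨le_rfl, hT⟩
  have h00 : ((0 : ℝ), (0 : X)) ∈ Set.Icc 0 T ×ˢ Metric.closedBall (0 : X) (max R 0) :=
    ⟨h0, by simp⟩
  obtain ⟨⟨t, x⟩, htx, hmax⟩ := (isCompact_Icc.prod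
    (isCompact_closedBall (0 : X) (max R 0))).exists_isMaxOn ⟨_, h00⟩
    (hc.mono (Set.prod_mono le_rfl (Set.subset_univ _)))
  refine ⟨t, htx.1, x, fun t' ht' x' => ?_⟩
  by_cases hx' : ‖x'‖ ≤ max R 0
  · exact hmax ⟨ht', by simpa using hx'⟩
  · exact (hR t' ht' x' ((le_max_left _ _).trans_lt (not_le.1 hx'))).trans (hmax h00)

/-- Only left slopes are used, so the maximum may sit at the final time of the interval. -/
theorem HasDerivAt.nonneg_of_max {g : ℝ → ℝ} {a t : ℝ} (hg : HasDerivAt g a t) (ht : 0 < t)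
    (hmax : ∀ τ, 0 ≤ τ → τ ≤ t → g τ ≤ g t) : 0 ≤ a := by
  have h := (hasDerivWithinAt_iff_tendsto_slope' (s := Set.Iio t) (by simp)).1
    hg.hasDerivWithinAt
  refine ge_of_tendsto h ?_
  filter_upwards [Ioo_mem_nhdsLT ht] with τ hτ
  rw [slope_def_field]
  exact div_nonneg_of_nonpos (by linarith [hmax τ hτ.1.le hτ.2.le]) (by linarith [hτ.2])

end Maximum

/-! ### Gradients at touching points and Lipschitz bounds. -/

section Gradient

variable {X : Type*} [NormedAddCommGroup X] [InnerProductSpace ℝ X] [CompleteSpace X]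

theorem gradient_eq_of_le_paraboloid {f : X → ℝ} {x p : X} {C : ℝ} (hf : DifferentiableAt ℝ f x)
    (h : ∀ z, f (x + z) ≤ f x + ⟪p, z⟫ + C * ‖z‖ ^ 2) : gradient f x = p := by
  have hmax : IsLocalMax (fun y => f y - ⟪p, y⟫ - C * ‖y - x‖ ^ 2) x := by
    refine Eventually.of_forall fun y => ?_
    have := h (y - x)
    rw [add_sub_cancel, inner_sub_right] at this
    simp only [sub_self, norm_zero]
    linarith
  have h1 : HasFDerivAt (fun y => ‖y - x‖ ^ 2) (0 : X →L[ℝ] ℝ) x := by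
    have := ((hasFDerivAt_id x).sub_const x).norm_sq
    simpa using this
  have h2 : HasFDerivAt (fun y => ⟪p, y⟫) (innerSL ℝ p) x := (innerSL ℝ p).hasFDerivAt
  have h3 := hmax.hasFDerivAt_eq_zero ((hf.hasFDerivAt.sub h2).sub (h1.const_mul C))
  refine ext_inner_right ℝ fun z => ?_
  rw [inner_gradient_left]
  have := congrArg (fun l : X →L[ℝ] ℝ => l z) h3
  simpa [sub_eq_zero] using this

theorem gradient_eq_of_paraboloid_le {f : X → ℝ} {x p : X} {C : ℝ} (hf : DifferentiableAt ℝ f x)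
    (h : ∀ z, f x + ⟪p, z⟫ - C * ‖z‖ ^ 2 ≤ f (x + z)) : gradient f x = p := by
  have := gradient_eq_of_le_paraboloid (f := fun y => -f y) (p := -p) (C := C) hf.neg
    fun z => by rw [inner_neg_left]; linarith [h z]
  rw [gradient, fderiv_fun_neg, map_neg, neg_inj] at this
  exact this

theorem le_add_of_norm_gradient_le {f : X → ℝ} {L : ℝ} (hf : Differentiable ℝ f)
    (hL : ∀ x, ‖gradient f x‖ ≤ L) (x y : X) : f x ≤ f y + L * ‖x - y‖ := by
  have h := convex_univ.norm_image_sub_le_of_norm_fderiv_le (f := f) (𝕜 := ℝ) (C := L)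
    (fun x _ => hf x) (fun x _ => by
      rw [← toDual_gradient, LinearIsometryEquiv.norm_map]; exact hL x)
    (Set.mem_univ y) (Set.mem_univ x)
  have := (le_abs_self _).trans h
  linarith

end Gradient

/-- An a priori bound: a function that is uniformly Lipschitz in space, and whose time derivative
is bounded by `K` where it is touched from above by a fixed paraboloid, grows at most linearly in
time, uniformly in space. -/
theorem le_add_of_deriv_le_at_paraboloid {X : Type*} [NormedAddCommGroup X]
    [InnerProductSpace ℝ X] [ProperSpace X] {f : ℝ → X → ℝ} {T L K : ℝ}
    (hc : ContinuousOn (fun q : ℝ × X => f q.1 q.2) (Set.Icc 0 T ×ˢ Set.univ))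
    (hL : 0 ≤ L) (hLip : ∀ t ∈ Set.Icc 0 T, ∀ x y, f t x ≤ f t y + L * ‖x - y‖) (hK : 0 ≤ K)
    (hder : ∀ t ∈ Set.Ioc 0 T, ∀ x p,
      (∀ z, f t (x + z) ≤ f t x + ⟪p, z⟫ + (L + 1) / 2 * ‖z‖ ^ 2) →
      ∃ a ≤ K, HasDerivAt (fun τ => f τ x) a t) :
    ∀ t ∈ Set.Icc 0 T, ∀ x, f t x ≤ f 0 x + (L + 1) + (K + 1) * t := by
  intro t₀ ht₀ x₀
  have hT : 0 ≤ T := ht₀.1.trans ht₀.2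
  have h0 : (0 : ℝ) ∈ Set.Icc 0 T := ⟨le_rfl, hT⟩
  obtain ⟨A, hA⟩ : ∃ A, ∀ t ∈ Set.Icc 0 T, f t x₀ ≤ A := by
    have hcx : ContinuousOn (fun t => f t x₀) (Set.Icc 0 T) :=
      hc.comp (f := fun t : ℝ => (t, x₀)) (by fun_prop) fun t ht => ⟨ht, Set.mem_univ _⟩
    obtain ⟨t, _, ht⟩ := isCompact_Icc.exists_isMaxOn ⟨0, h0⟩ hcx
    exact ⟨f t x₀, fun τ hτ => ht hτ⟩
  -- The penalty slope `L + 1` beats the Lipschitz constant `L`, which gives coercivity; the rate `K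
  -- + 1` beats `K`, which excludes a maximum at positive time. Centering at `x₀` makes the bound
  -- uniform in space.
  set Φ : ℝ × X → ℝ := fun q => f q.1 (x₀ + q.2) - (L + 1) * bracket q.2 - (K + 1) * q.1 with hΦ
  have hΦc : ContinuousOn Φ (Set.Icc 0 T ×ˢ Set.univ) := by
    refine ((hc.comp (f := fun q : ℝ × X => (q.1, x₀ + q.2)) (by fun_prop)
      fun q hq => ⟨hq.1, Set.mem_univ _⟩).sub ?_).sub ?_ <;> fun_prop
  obtain ⟨t, ht, z, hmax⟩ := exists_max_of_coercive (R := A - Φ (0, 0)) hT hΦc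
    fun t ht z hz => by
      have h1 := hLip t ht (x₀ + z) x₀
      rw [add_sub_cancel_left] at h1
      have h2 := mul_le_mul_of_nonneg_left (norm_le_bracket z) (by linarith : 0 ≤ L + 1)
      have h3 := mul_nonneg (by linarith : 0 ≤ K + 1) ht.1
      have h4 := hA t ht
      have h5 : Φ (t, z) = f t (x₀ + z) - (L + 1) * bracket z - (K + 1) * t := rfl
      linarith
  simp only [hΦ] at hmax
  rcases ht.1.eq_or_lt with rfl | htpos
  · have h1 := hmax t₀ ht₀ 0
    have h2 := hLip 0 h0 (x₀ + z) x₀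
    rw [add_sub_cancel_left] at h2
    have h3 := mul_le_mul_of_nonneg_left (norm_le_bracket z) (by linarith : 0 ≤ L + 1)
    rw [add_zero, bracket_zero] at h1
    linarith [norm_nonneg z]
  · exfalso
    obtain ⟨a, haK, ha⟩ := hder t ⟨htpos, ht.2⟩ (x₀ + z) ((L + 1) • (bracket z)⁻¹ • z) fun w => by
      have h1 := hmax t ht (z + w)
      have h2 := mul_le_mul_of_nonneg_left (bracket_add_le z w) (by linarith : 0 ≤ L + 1)
      rw [real_inner_smul_left, add_assoc]
      linarith
    have h3 := ((ha.sub_const ((L + 1) * bracket z)).sub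
      ((hasDerivAt_id t).const_mul (K + 1))).nonneg_of_max htpos
      fun τ hτ hτt => hmax τ ⟨hτ, hτt.trans ht.2⟩ z
    linarith

/-! ### The comparison principle by doubling of variables. -/

section Comparison

variable {d : ℕ}

theorem areaFactor_eq_bracket (f : EuclideanSpace ℝ (Fin d) → ℝ) (x : EuclideanSpace ℝ (Fin d)) :
    areaFactor f x = bracket (gradient f x) := rfl

theorem exists_rpow_mul_le {θ c μ : ℝ} (hθ : 0 < θ) (hμ : 0 < μ) :
    ∃ r : ℝ, 0 < r ∧ r ≤ 1 ∧ c * r ^ θ ≤ μ := by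
  have h : Tendsto (fun r : ℝ => c * r ^ θ) (𝓝[>] 0) (𝓝 0) := by
    have h1 : ContinuousAt (fun r : ℝ => c * r ^ θ) 0 :=
      (Real.continuousAt_rpow_const 0 θ (Or.inr hθ.le)).const_mul c
    have h2 := h1.tendsto
    rw [Real.zero_rpow hθ.ne', mul_zero] at h2
    exact h2.mono_left nhdsWithin_le_nhds
  obtain ⟨r, hr, hr'⟩ := ((h.eventually (ge_mem_nhds hμ)).and (Ioc_mem_nhdsGT one_pos)).exists
  exact ⟨r, hr'.1, hr'.2, hr⟩

/-- At a maximum of `f x - g y - |x - y|² / (2η) - ε √(1 + |x|²)`, the speeds of the graphs of `f`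
and `g` are ordered up to an error that is small with `ε`, uniformly in `f` and `g`. -/
theorem exists_speed_gap_lt (d : ℕ) {s L η μ : ℝ} (hs0 : 0 < s) (hs1 : s < 1) (hη : 0 < η)
    (hμ : 0 < μ) :
    ∃ ε₀ > 0, ∀ ε, 0 < ε → ε ≤ ε₀ → ∀ f g : EuclideanSpace ℝ (Fin d) → ℝ,
      Differentiable ℝ f → Differentiable ℝ g → (∀ y, ‖gradient g y‖ ≤ L) →
      (∀ x, ∃ h, HasFracMeanCurvature s (subgraph f) (graphPoint f x) h) →
      (∀ y, ∃ h, HasFracMeanCurvature s (subgraph g) (graphPoint g y) h) →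
      ∀ x y, (∀ x' y', f x' - g y' - ‖x' - y'‖ ^ 2 / (2 * η) - ε * bracket x' ≤
        f x - g y - ‖x - y‖ ^ 2 / (2 * η) - ε * bracket x) →
      areaFactor g y * graphCurvature s g y - areaFactor f x * graphCurvature s f x < μ := by
  obtain ⟨N, θ, hN, hθ, hpar⟩ := exists_curvature_bounds_of_paraboloid d hs0 hs1
  obtain ⟨B, hB, htr⟩ := exists_abs_truncatedFracMeanCurvature_le d hs0 hs1
  set C : ℝ := 1 / (2 * η) + 1 / 2 with hC
  have hC0 : 0 ≤ C := by positivity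
  set V : ℝ := Real.sqrt (1 + L ^ 2) with hV
  have hV0 : 0 ≤ V := Real.sqrt_nonneg _
  set D : ℝ := B + C * N with hD
  have hD0 : 0 ≤ D := by positivity
  -- The order of choices matters: `r` depends on `η`, `L`, `μ` only, and `ε₀` is taken after `r`
  -- because the far-field constant `N'` blows up as `r` shrinks.
  obtain ⟨r, hr, hr1, hrμ⟩ := exists_rpow_mul_le (c := V * (2 * (C * N))) hθ
    (by positivity : 0 < μ / 4)
  obtain ⟨N', hN', hfar⟩ := exists_truncatedFracMeanCurvature_le d hs0 hs1 hr
  have hden : 0 < 4 * (D + V * N' + 1) := by positivity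
  refine ⟨min 1 (μ / (4 * (D + V * N' + 1))), lt_min one_pos (by positivity), ?_⟩
  intro ε hε hε₀ f g hf hg hgL hfH hgH x y hmax
  have hε1 : ε ≤ 1 := hε₀.trans (min_le_left _ _)
  have hεμ : ε * (D + V * N') ≤ μ / 4 := by
    have := hε₀.trans (min_le_right _ _)
    rw [le_div_iff₀ hden] at this
    nlinarith
  obtain ⟨hF, hhF⟩ := hfH x
  obtain ⟨hG, hhG⟩ := hgH y
  rw [hhF.eq_graphCurvature, hhG.eq_graphCurvature, areaFactor_eq_bracket, areaFactor_eq_bracket]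
  set p := η⁻¹ • (x - y) with hp
  have hpz : ∀ z, ⟪p, z⟫ = 2 * ⟪x - y, z⟫ / (2 * η) := fun z => by
    rw [hp, real_inner_smul_left]; field_simp
  have hfup : ∀ z, f (x + z) ≤ f x + ⟪p + ε • (bracket x)⁻¹ • x, z⟫ + C * ‖z‖ ^ 2 := fun z => by
    have h1 := hmax (x + z) y
    have h2 := mul_le_mul_of_nonneg_left (bracket_add_le x z) hε.le
    have h3 : ‖x + z - y‖ ^ 2 / (2 * η) =
        ‖x - y‖ ^ 2 / (2 * η) + ⟪p, z⟫ + 1 / (2 * η) * ‖z‖ ^ 2 := by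
      rw [show x + z - y = x - y + z by abel, norm_add_sq_real, hpz]; ring
    have h4 : ε * (1 / 2 * ‖z‖ ^ 2) ≤ 1 / 2 * ‖z‖ ^ 2 :=
      mul_le_of_le_one_left (by positivity) hε1
    rw [inner_add_left, real_inner_smul_left ((bracket x)⁻¹ • x) z ε, hC, add_mul]
    linarith
  have hglo' : ∀ z, g y + ⟪p, z⟫ - 1 / (2 * η) * ‖z‖ ^ 2 ≤ g (y + z) := fun z => by
    have h1 := hmax x (y + z)
    have h3 : ‖x - (y + z)‖ ^ 2 / (2 * η) =
        ‖x - y‖ ^ 2 / (2 * η) - ⟪p, z⟫ + 1 / (2 * η) * ‖z‖ ^ 2 := by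
      rw [show x - (y + z) = x - y - z by abel, norm_sub_sq_real, hpz]; ring
    linarith
  have hglo : ∀ z, g y + ⟪p, z⟫ - C * ‖z‖ ^ 2 ≤ g (y + z) := fun z => by
    have h1 := hglo' z
    rw [hC, add_mul]
    linarith [sq_nonneg ‖z‖]
  -- Translating both variables by `z` leaves `x - y` unchanged, so the quadratic penalty drops out
  -- and only the `ε` term remains.
  have hshift : ∀ z, f (x + z) - f x ≤ g (y + z) - g y + ε * ‖z‖ := fun z => by
    have h1 := hmax (x + z) (y + z)
    rw [add_sub_add_right_eq_sub] at h1
    have h2 := mul_le_mul_of_nonneg_left (bracket_add_le_norm x z) hε.le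
    linarith
  have hgradf := gradient_eq_of_le_paraboloid (hf x) hfup
  have hgradg := gradient_eq_of_paraboloid_le (hg y) hglo
  have hpf := fun r hr hr1 =>
    (hpar f x (p + ε • (bracket x)⁻¹ • x) C r hF hf.continuous hC0 hr hr1 hhF).1 hfup
  have hpg := fun r hr hr1 => (hpar g y p C r hG hg.continuous hC0 hr hr1 hhG).2 hglo
  have hFlow : -D ≤ hF := by
    have h1 := hpf 1 one_pos le_rfl
    rw [Real.one_rpow, mul_one] at h1
    linarith [neg_le_of_abs_le (htr f x)]
  have hGup : hG ≤ D := by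
    have h1 := hpg 1 one_pos le_rfl
    rw [Real.one_rpow, mul_one] at h1
    linarith [le_of_abs_le (htr g y)]
  have hGF : hG ≤ hF + (2 * (C * N * r ^ θ) + ε * N') := by
    linarith [hpf r hr hr1, hpg r hr hr1, hfar f g x y ε hf.continuous hg.continuous hε.le hshift]
  set e : ℝ := 2 * (C * N * r ^ θ) + ε * N' with he
  have he0 : 0 ≤ e := by positivity
  have hGV : bracket (gradient g y) ≤ V := bracket_le_of_norm_le (hgL y)
  have hsmall : ‖ε • (bracket x)⁻¹ • x‖ ≤ ε := by
    rw [norm_smul, Real.norm_of_nonneg hε.le]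
    exact mul_le_of_le_one_right hε.le (norm_inv_bracket_smul_le x)
  have hFG : |bracket (gradient g y) - bracket (gradient f x)| ≤ ε := by
    rw [hgradf, hgradg, abs_le]
    have h1 := bracket_add_le_norm p (ε • (bracket x)⁻¹ • x)
    have h2 := bracket_add_le_norm (p + ε • (bracket x)⁻¹ • x) (-(ε • (bracket x)⁻¹ • x))
    rw [norm_neg, add_neg_cancel_right] at h2
    constructor <;> linarith
  have hvf := bracket_pos (gradient f x)
  have hvg := bracket_pos (gradient g y)
  set vf := bracket (gradient f x)
  set vg := bracket (gradient g y)
  -- The paraboloids give only `hF ≥ -D` and `hG ≤ D`. Truncating `hF` at `D` keeps the order up to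
  -- `e` and makes `(vg - vf) * m` of size `ε D`.
  set m := min hF D with hm
  have hm1 : |m| ≤ D := abs_le.2 ⟨le_min hFlow (by linarith), min_le_right _ _⟩
  have hm2 : hG ≤ m + e := by
    rcases min_choice hF D with h | h <;> rw [hm, h] <;> linarith
  have hprod : (vg - vf) * m ≤ ε * D :=
    (le_abs_self _).trans (by rw [abs_mul]; gcongr)
  calc vg * hG - vf * hF ≤ vg * (m + e) - vf * m := by
        have := mul_le_mul_of_nonneg_left hm2 hvg.le
        have := mul_le_mul_of_nonneg_left (min_le_left hF D) hvf.le
        linarith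
    _ = (vg - vf) * m + vg * e := by ring
    _ ≤ ε * D + V * e := add_le_add hprod (mul_le_mul_of_nonneg_right hGV he0)
    _ = ε * (D + V * N') + V * (2 * (C * N)) * r ^ θ := by rw [he]; ring
    _ < μ := by linarith

/-- A family of graphs on `[0, T]` with slope at most `L` and well defined curvature. -/
structure IsGraphFamily (s T L : ℝ) (u : ℝ → EuclideanSpace ℝ (Fin d) → ℝ) : Prop where
  continuousOn : ContinuousOn (fun q : ℝ × EuclideanSpace ℝ (Fin d) => u q.1 q.2)
    (Set.Icc 0 T ×ˢ Set.univ)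
  differentiable : ∀ t ∈ Set.Icc 0 T, Differentiable ℝ (u t)
  norm_gradient_le : ∀ t ∈ Set.Icc 0 T, ∀ x, ‖gradient (u t) x‖ ≤ L
  hasCurvature : ∀ t ∈ Set.Icc 0 T, ∀ x,
    ∃ h, HasFracMeanCurvature s (subgraph (u t)) (graphPoint (u t) x) h

theorem IsGraphFamily.le_add {s T L : ℝ} {u : ℝ → EuclideanSpace ℝ (Fin d) → ℝ}
    (hu : IsGraphFamily s T L u) {t : ℝ} (ht : t ∈ Set.Icc 0 T) (x y : EuclideanSpace ℝ (Fin d)) :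
    u t x ≤ u t y + L * ‖x - y‖ :=
  le_add_of_norm_gradient_le (hu.differentiable t ht) (hu.norm_gradient_le t ht) x y

/-- The comparison principle, with the penalization parameters still present. -/
theorem IsGraphFamily.exists_le_add_penalization {s T L M₁ M₂ m K : ℝ} (hs0 : 0 < s) (hs1 : s < 1)
    {u w : ℝ → EuclideanSpace ℝ (Fin d) → ℝ}
    (hu : IsGraphFamily s T L u) (hw : IsGraphFamily s T L w)
    (hM : 0 ≤ M₁ + M₂)
    (hsub : ∀ t ∈ Set.Ioc 0 T, ∀ x, ∃ a, HasDerivAt (fun τ => u τ x) a t ∧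
      a ≤ -(areaFactor (u t) x * graphCurvature s (u t) x) + M₁)
    (hsuper : ∀ t ∈ Set.Ioc 0 T, ∀ x, ∃ a, HasDerivAt (fun τ => w τ x) a t ∧
      -(areaFactor (w t) x * graphCurvature s (w t) x) - M₂ ≤ a)
    (hbdd : ∀ t ∈ Set.Icc 0 T, ∀ x, u t x ≤ w t x + K)
    (hinit : ∀ x, u 0 x ≤ w 0 x + m) {η μ : ℝ} (hη : 0 < η) (hμ : 0 < μ) :
    ∃ ε₀ > 0, ∀ ε, 0 < ε → ε ≤ ε₀ → ∀ t ∈ Set.Icc 0 T, ∀ x,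
      u t x ≤ w t x + m + L ^ 2 * η / 2 + ε * bracket x + (M₁ + M₂ + μ) * t := by
  obtain ⟨ε₀, hε₀, hgap⟩ := exists_speed_gap_lt d (L := L) hs0 hs1 hη hμ
  refine ⟨ε₀, hε₀, fun ε hε hεε₀ t₀ ht₀ x₀ => ?_⟩
  have hT : 0 ≤ T := ht₀.1.trans ht₀.2
  have hpen : ∀ t ∈ Set.Icc 0 T, ∀ k, (∀ x, u t x ≤ w t x + k) → ∀ x y,
      u t x - w t y - ‖x - y‖ ^ 2 / (2 * η) ≤ k + L * ‖x - y‖ - ‖x - y‖ ^ 2 / (2 * η) :=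
    fun t ht k hk x y => by linarith [hk x, hw.le_add ht x y]
  -- Young's inequality: the cost of doubling at the initial time is `L² η / 2`.
  have hyoung : ∀ ρ η : ℝ, 0 < η → L * ρ - ρ ^ 2 / (2 * η) ≤ L ^ 2 * η / 2 := fun ρ η hη => by
    have h : L ^ 2 * η / 2 - (L * ρ - ρ ^ 2 / (2 * η)) = (L * η - ρ) ^ 2 / (2 * η) := by
      field_simp; ring
    have : 0 ≤ (L * η - ρ) ^ 2 / (2 * η) := by positivity
    linarith
  set Φ : ℝ × (EuclideanSpace ℝ (Fin d) × EuclideanSpace ℝ (Fin d)) → ℝ := fun q =>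
    u q.1 q.2.1 - w q.1 q.2.2 - ‖q.2.1 - q.2.2‖ ^ 2 / (2 * η) - ε * bracket q.2.1
      - (M₁ + M₂ + μ) * q.1 with hΦ
  have hΦc : ContinuousOn Φ (Set.Icc 0 T ×ˢ Set.univ) := by
    have h1 := hu.continuousOn.comp (s := Set.Icc (0 : ℝ) T ×ˢ Set.univ)
      (f := fun q : ℝ × (EuclideanSpace ℝ (Fin d) × EuclideanSpace ℝ (Fin d)) => (q.1, q.2.1))
      (by fun_prop) fun q hq => ⟨hq.1, Set.mem_univ _⟩
    have h2 := hw.continuousOn.comp (s := Set.Icc (0 : ℝ) T ×ˢ Set.univ)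
      (f := fun q : ℝ × (EuclideanSpace ℝ (Fin d) × EuclideanSpace ℝ (Fin d)) => (q.1, q.2.2))
      (by fun_prop) fun q hq => ⟨hq.1, Set.mem_univ _⟩
    refine (((h1.sub h2).sub ?_).sub ?_).sub ?_ <;> fun_prop
  -- Young with `2η` uses half of the quadratic penalty; the other half forces `‖x - y‖` to stay
  -- bounded, and the bracket then bounds `x`.
  obtain ⟨ρ₀, hρ₀⟩ : ∃ ρ₀ : ℝ, ∀ ρ, ρ₀ < ρ → K + L * ρ - ρ ^ 2 / (2 * η) ≤ Φ (0, 0) := by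
    refine ⟨|4 * η * (K + L ^ 2 * η - Φ (0, 0))| + 1, fun ρ hρ => ?_⟩
    have h1 := hyoung ρ (2 * η) (by positivity)
    have h2 : 4 * η * (K + L ^ 2 * η - Φ (0, 0)) ≤ ρ ^ 2 := by
      nlinarith [le_abs_self (4 * η * (K + L ^ 2 * η - Φ (0, 0))),
        abs_nonneg (4 * η * (K + L ^ 2 * η - Φ (0, 0)))]
    have h3 : K + L ^ 2 * η - Φ (0, 0) ≤ ρ ^ 2 / (4 * η) := by
      rw [le_div_iff₀ (by positivity)]; linarith
    have h4 : ρ ^ 2 / (2 * η) = ρ ^ 2 / (2 * (2 * η)) + ρ ^ 2 / (4 * η) := by field_simp; ring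
    linarith
  obtain ⟨t, ht, ⟨x, y⟩, hmax⟩ := exists_max_of_coercive
    (R := max ((K + L ^ 2 * η / 2 - Φ (0, 0)) / ε) 0 + max ρ₀ 0) hT hΦc
    fun t ht q hq => by
      have h1 := hpen t ht K (hbdd t ht) q.1 q.2
      have h2 : 0 ≤ (M₁ + M₂ + μ) * t := mul_nonneg (by linarith) ht.1
      have h3 : ε * ‖q.1‖ ≤ ε * bracket q.1 := by gcongr; exact norm_le_bracket _
      have h4 : 0 ≤ ε * ‖q.1‖ := by positivity
      have h5 : Φ (t, q) = u t q.1 - w t q.2 - ‖q.1 - q.2‖ ^ 2 / (2 * η) - ε * bracket q.1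
        - (M₁ + M₂ + μ) * t := rfl
      by_cases hq1 : ρ₀ < ‖q.1 - q.2‖
      · linarith [hρ₀ _ hq1]
      · have h6 : (K + L ^ 2 * η / 2 - Φ (0, 0)) / ε < ‖q.1‖ := by
          refine (le_max_left _ 0).trans_lt (lt_of_not_ge fun hle => hq.not_ge ?_)
          have h7 : ‖q.2‖ ≤ ‖q.1‖ + ‖q.1 - q.2‖ := by
            have := norm_sub_le q.1 (q.1 - q.2)
            rwa [sub_sub_cancel] at this
          refine max_le ?_ ?_ <;> linarith [le_max_left ρ₀ 0, le_max_right ρ₀ 0]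
        rw [div_lt_iff₀ hε] at h6
        linarith [hyoung ‖q.1 - q.2‖ η hη]
  simp only [hΦ] at hmax
  have h0 := hmax t₀ ht₀ (x₀, x₀)
  simp only [sub_self, norm_zero, zero_pow two_ne_zero, zero_div, sub_zero] at h0
  rcases ht.1.eq_or_lt with rfl | htpos
  · have h1 := hpen 0 ⟨le_rfl, hT⟩ m hinit x y
    have h2 := hyoung ‖x - y‖ η hη
    have h3 := mul_pos hε (bracket_pos x)
    linarith
  · exfalso
    -- Maximality in time gives `a - b ≥ M₁ + M₂ + μ`, while the equations and the speed gap give `a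
    -- - b < M₁ + M₂ + μ`.
    obtain ⟨a, ha, ha'⟩ := hsub t ⟨htpos, ht.2⟩ x
    obtain ⟨b, hb, hb'⟩ := hsuper t ⟨htpos, ht.2⟩ y
    have h1 := ((((ha.sub hb).sub_const (‖x - y‖ ^ 2 / (2 * η))).sub_const (ε * bracket x)).sub
      ((hasDerivAt_id t).const_mul (M₁ + M₂ + μ))).nonneg_of_max htpos
      fun τ hτ hτt => hmax τ ⟨hτ, hτt.trans ht.2⟩ (x, y)
    have h2 := hgap ε hε hεε₀ (u t) (w t) (hu.differentiable t ht) (hw.differentiable t ht)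
      (hw.norm_gradient_le t ht) (hu.hasCurvature t ht) (hw.hasCurvature t ht) x y
      fun x' y' => by linarith [hmax t ht (x', y')]
    linarith

/-- The comparison principle for the graphical flow with constant forcing. -/
theorem IsGraphFamily.le_add_of_subsolution {s T L M₁ M₂ m K : ℝ} (hs0 : 0 < s) (hs1 : s < 1)
    {u w : ℝ → EuclideanSpace ℝ (Fin d) → ℝ}
    (hu : IsGraphFamily s T L u) (hw : IsGraphFamily s T L w)
    (hM : 0 ≤ M₁ + M₂)
    (hsub : ∀ t ∈ Set.Ioc 0 T, ∀ x, ∃ a, HasDerivAt (fun τ => u τ x) a t ∧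
      a ≤ -(areaFactor (u t) x * graphCurvature s (u t) x) + M₁)
    (hsuper : ∀ t ∈ Set.Ioc 0 T, ∀ x, ∃ a, HasDerivAt (fun τ => w τ x) a t ∧
      -(areaFactor (w t) x * graphCurvature s (w t) x) - M₂ ≤ a)
    (hbdd : ∀ t ∈ Set.Icc 0 T, ∀ x, u t x ≤ w t x + K)
    (hinit : ∀ x, u 0 x ≤ w 0 x + m) {t : ℝ} (ht : t ∈ Set.Icc 0 T)
    (x : EuclideanSpace ℝ (Fin d)) : u t x ≤ w t x + m + (M₁ + M₂) * t := by
  refine le_of_forall_pos_le_add fun κ hκ => ?_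
  -- The three errors, from `η`, `μ` and `ε`, each take `κ / 3`; `ε` is chosen last since `ε₀`
  -- depends on the other two.
  have hη : 0 < κ / (3 * (L ^ 2 + 1)) := by positivity
  have hμ : 0 < κ / (3 * (t + 1)) := div_pos hκ (by linarith [ht.1])
  obtain ⟨ε₀, hε₀, h⟩ := hu.exists_le_add_penalization hs0 hs1 hw hM hsub hsuper hbdd hinit hη hμ
  have hε : 0 < κ / (3 * bracket x) := div_pos hκ (by linarith [bracket_pos x])
  have h1 := h _ (lt_min hε₀ hε) (min_le_left _ _) t ht x
  have h2 : min ε₀ (κ / (3 * bracket x)) * bracket x ≤ κ / 3 := by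
    have h3 := mul_le_mul_of_nonneg_right (min_le_right ε₀ (κ / (3 * bracket x))) (bracket_pos x).le
    have h4 : κ / (3 * bracket x) * bracket x = κ / 3 := by field_simp [(bracket_pos x).ne']
    linarith
  have h3 : L ^ 2 * (κ / (3 * (L ^ 2 + 1))) / 2 ≤ κ / 3 := by
    have : L ^ 2 * (κ / (3 * (L ^ 2 + 1))) = κ / 3 * (L ^ 2 / (L ^ 2 + 1)) := by field_simp
    rw [this]
    have h4 : L ^ 2 / (L ^ 2 + 1) ≤ 1 := (div_le_one (by positivity)).2 (by linarith)
    have h5 : 0 ≤ L ^ 2 / (L ^ 2 + 1) := by positivity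
    nlinarith
  have h4 : κ / (3 * (t + 1)) * t ≤ κ / 3 := by
    have h5 : (0 : ℝ) < t + 1 := by linarith [ht.1]
    rw [div_mul_eq_mul_div, div_le_div_iff₀ (by positivity) (by positivity)]
    nlinarith
  linarith

end Comparison

/-! ### Time-Lipschitz bounds for the flow and the conclusion. -/

section Flow

variable {d : ℕ} {s L T' : ℝ} {T : EReal} {u : ℝ → EuclideanSpace ℝ (Fin d) → ℝ}

theorem IsGraphicalFlow.differentiable (hu : IsGraphicalFlow s T u) {t : ℝ} (ht : 0 ≤ t)
    (htT : (t : EReal) < T) : Differentiable ℝ (u t) := by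
  rcases ht.eq_or_lt with rfl | htpos
  · exact hu.contDiff_zero.differentiable one_ne_zero
  · intro x
    have hopen : IsOpen {q : ℝ × EuclideanSpace ℝ (Fin d) | 0 < q.1 ∧ (q.1 : EReal) < T} :=
      (isOpen_lt continuous_const continuous_fst).inter
        (isOpen_lt (continuous_coe_real_ereal.comp continuous_fst) continuous_const)
    have h := (hu.contDiffOn.contDiffAt (hopen.mem_nhds (x := (t, x)) ⟨htpos, htT⟩)).differentiableAt
      two_ne_zero
    exact h.comp (f := fun y : EuclideanSpace ℝ (Fin d) => (t, y)) x (by fun_prop)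

theorem coe_lt_of_le_of_coe_lt (hT' : (T' : EReal) < T) {t : ℝ} (ht : t ≤ T') : (t : EReal) < T :=
  (EReal.coe_le_coe_iff.2 ht).trans_lt hT'

theorem IsGraphicalFlow.isGraphFamily_shift (hu : IsGraphicalFlow s T u)
    (hL : ∀ t : ℝ, 0 ≤ t → (t : EReal) < T → ∀ x, ‖gradient (u t) x‖ ≤ L)
    (hT' : (T' : EReal) < T) {h : ℝ} (hh : 0 ≤ h) :
    IsGraphFamily s (T' - h) L fun t => u (t + h) := by
  have hlt : ∀ t ∈ Set.Icc 0 (T' - h), 0 ≤ t + h ∧ ((t + h : ℝ) : EReal) < T := fun t ht =>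
    ⟨by linarith [ht.1], coe_lt_of_le_of_coe_lt hT' (by linarith [ht.2])⟩
  refine ⟨?_, fun t ht => hu.differentiable (hlt t ht).1 (hlt t ht).2,
    fun t ht => hL _ (hlt t ht).1 (hlt t ht).2,
    fun t ht => hu.hasCurvature _ (hlt t ht).1 (hlt t ht).2⟩
  exact hu.continuousOn.comp
    (f := fun q : ℝ × EuclideanSpace ℝ (Fin d) => (q.1 + h, q.2)) (by fun_prop)
    fun q hq => hlt q.1 hq.1

theorem IsGraphicalFlow.isGraphFamily (hu : IsGraphicalFlow s T u)
    (hL : ∀ t : ℝ, 0 ≤ t → (t : EReal) < T → ∀ x, ‖gradient (u t) x‖ ≤ L)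
    (hT' : (T' : EReal) < T) : IsGraphFamily s T' L u := by
  simpa using hu.isGraphFamily_shift hL hT' le_rfl

theorem IsGraphicalFlow.isGraphFamily_zero (hu : IsGraphicalFlow s T u) (hT : 0 < T)
    (hL : ∀ t : ℝ, 0 ≤ t → (t : EReal) < T → ∀ x, ‖gradient (u t) x‖ ≤ L) (T' : ℝ) :
    IsGraphFamily s T' L fun _ => u 0 :=
  ⟨(hu.contDiff_zero.continuous.comp continuous_snd).continuousOn,
    fun _ _ => hu.differentiable le_rfl hT, fun _ _ => hL 0 le_rfl hT,
    fun _ _ => hu.hasCurvature 0 le_rfl hT⟩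

/-- On compact time intervals the flow stays at bounded distance from the initial graph. -/
theorem IsGraphicalFlow.exists_abs_sub_zero_le (hs0 : 0 < s) (hs1 : s < 1)
    (hu : IsGraphicalFlow s T u)
    (hL : ∀ t : ℝ, 0 ≤ t → (t : EReal) < T → ∀ x, ‖gradient (u t) x‖ ≤ L)
    (hL0 : 0 ≤ L) (hT' : (T' : EReal) < T) :
    ∃ K, ∀ t ∈ Set.Icc 0 T', ∀ x, |u t x - u 0 x| ≤ K := by
  have hfam := hu.isGraphFamily hL hT'
  obtain ⟨N, θ, hN, hθ, hpar⟩ := exists_curvature_bounds_of_paraboloid d hs0 hs1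
  obtain ⟨B, hB, htr⟩ := exists_abs_truncatedFracMeanCurvature_le d hs0 hs1
  set D : ℝ := B + (L + 1) / 2 * N with hD
  have hD0 : 0 ≤ D := by positivity
  set K : ℝ := Real.sqrt (1 + L ^ 2) * D with hK
  have hK0 : 0 ≤ K := by positivity
  have hv : ∀ t ∈ Set.Icc 0 T', ∀ x, 0 ≤ areaFactor (u t) x ∧
      areaFactor (u t) x ≤ Real.sqrt (1 + L ^ 2) := fun t ht x =>
    ⟨Real.sqrt_nonneg _, bracket_le_of_norm_le (hfam.norm_gradient_le t ht x)⟩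
  -- Touching from above gives `H_s ≥ -D`, hence `∂ₜu = -v H_s ≤ K`. The lower bound applies the
  -- same argument to `-u`.
  have hup := le_add_of_deriv_le_at_paraboloid (f := u) hfam.continuousOn hL0
    (fun t ht => hfam.le_add ht) hK0 fun t ht x p hp => by
      have ht' : t ∈ Set.Icc 0 T' := ⟨ht.1.le, ht.2⟩
      obtain ⟨h, hh⟩ := hfam.hasCurvature t ht' x
      refine ⟨_, ?_, hu.evolution t ht.1 (coe_lt_of_le_of_coe_lt hT' ht.2) x⟩
      have h1 := (hpar (u t) x p ((L + 1) / 2) 1 h (hfam.differentiable t ht').continuous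
        (by positivity) one_pos le_rfl hh).1 hp
      rw [Real.one_rpow, mul_one] at h1
      have h2 : -D ≤ h := by linarith [neg_le_of_abs_le (htr (u t) x)]
      rw [hh.eq_graphCurvature]
      have h3 := mul_le_mul_of_nonneg_left h2 (hv t ht' x).1
      have h4 := mul_le_mul_of_nonneg_right (hv t ht' x).2 hD0
      linarith
  have hlo := le_add_of_deriv_le_at_paraboloid (f := fun t x => -u t x) hfam.continuousOn.neg hL0
    (fun t ht x y => by
      have := hfam.le_add ht y x
      rw [norm_sub_rev] at this
      linarith) hK0 fun t ht x p hp => by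
      have ht' : t ∈ Set.Icc 0 T' := ⟨ht.1.le, ht.2⟩
      obtain ⟨h, hh⟩ := hfam.hasCurvature t ht' x
      refine ⟨_, ?_, (hu.evolution t ht.1 (coe_lt_of_le_of_coe_lt hT' ht.2) x).neg⟩
      have h1 := (hpar (u t) x (-p) ((L + 1) / 2) 1 h (hfam.differentiable t ht').continuous
        (by positivity) one_pos le_rfl hh).2 fun z => by
          rw [inner_neg_left]; linarith [hp z]
      rw [Real.one_rpow, mul_one] at h1
      have h2 : h ≤ D := by linarith [le_of_abs_le (htr (u t) x)]
      rw [hh.eq_graphCurvature, neg_neg]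
      have h3 := mul_le_mul_of_nonneg_left h2 (hv t ht' x).1
      have h4 := mul_le_mul_of_nonneg_right (hv t ht' x).2 hD0
      linarith
  refine ⟨L + 1 + (K + 1) * T', fun t ht x => ?_⟩
  have h1 := hup t ht x
  have h2 := hlo t ht x
  have h3 := mul_le_mul_of_nonneg_left ht.2 (by linarith : 0 ≤ K + 1)
  exact abs_le.2 ⟨by linarith, by linarith⟩

/-- The constant-in-time graph `u 0` has zero velocity and speed term at most `M`, so it is both a
supersolution and a subsolution with forcing `M`. -/
theorem IsGraphicalFlow.abs_sub_zero_le (hs0 : 0 < s) (hs1 : s < 1) (hT : 0 < T)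
    (hu : IsGraphicalFlow s T u)
    (hL : ∀ t : ℝ, 0 ≤ t → (t : EReal) < T → ∀ x, ‖gradient (u t) x‖ ≤ L) {M : ℝ}
    (hM : ∀ x, |areaFactor (u 0) x * graphCurvature s (u 0) x| ≤ M) {t : ℝ} (ht : 0 ≤ t)
    (htT : (t : EReal) < T) (x : EuclideanSpace ℝ (Fin d)) : |u t x - u 0 x| ≤ M * t := by
  have hL0 : 0 ≤ L := (norm_nonneg _).trans (hL 0 le_rfl hT 0)
  have hM0 : 0 ≤ M := (abs_nonneg _).trans (hM 0)
  obtain ⟨K, hK⟩ := hu.exists_abs_sub_zero_le hs0 hs1 hL hL0 htT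
  have hfam := hu.isGraphFamily hL htT
  have hfam0 := hu.isGraphFamily_zero hT hL t
  have hmem : t ∈ Set.Icc 0 t := ⟨ht, le_rfl⟩
  have hev : ∀ τ ∈ Set.Ioc 0 t, ∀ y, HasDerivAt (fun τ => u τ y)
      (-(areaFactor (u τ) y * graphCurvature s (u τ) y)) τ :=
    fun τ hτ => hu.evolution τ hτ.1 (coe_lt_of_le_of_coe_lt htT hτ.2)
  have h1 := hfam.le_add_of_subsolution (M₁ := 0) (M₂ := M) (m := 0) (K := K) hs0 hs1 hfam0
    (by linarith) (fun τ hτ y => ⟨_, hev τ hτ y, by linarith⟩)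
    (fun τ hτ y => ⟨0, hasDerivAt_const τ _, by linarith [neg_le_of_abs_le (hM y)]⟩)
    (fun τ hτ y => by linarith [le_of_abs_le (hK τ hτ y)]) (fun y => by linarith) hmem x
  have h2 := hfam0.le_add_of_subsolution (M₁ := M) (M₂ := 0) (m := 0) (K := K) hs0 hs1 hfam
    (by linarith)
    (fun τ hτ y => ⟨0, hasDerivAt_const τ _, by linarith [le_of_abs_le (hM y)]⟩)
    (fun τ hτ y => ⟨_, hev τ hτ y, by linarith⟩)
    (fun τ hτ y => by linarith [neg_le_of_abs_le (hK τ hτ y)]) (fun y => by linarith) hmem x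
  exact abs_le.2 ⟨by linarith, by linarith⟩

/-- The flow and its time shift solve the same unforced equation, so comparison propagates their
initial distance, at most `M h`. Their distances to `u 0` give the boundedness that comparison
needs. -/
theorem IsGraphicalFlow.abs_sub_le (hs0 : 0 < s) (hs1 : s < 1) (hT : 0 < T)
    (hu : IsGraphicalFlow s T u)
    (hL : ∀ t : ℝ, 0 ≤ t → (t : EReal) < T → ∀ x, ‖gradient (u t) x‖ ≤ L) {M : ℝ}
    (hM : ∀ x, |areaFactor (u 0) x * graphCurvature s (u 0) x| ≤ M) {t h : ℝ} (ht : 0 ≤ t)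
    (hh : 0 ≤ h) (htT : ((t + h : ℝ) : EReal) < T) (x : EuclideanSpace ℝ (Fin d)) :
    |u (t + h) x - u t x| ≤ M * h := by
  have hM0 : 0 ≤ M := (abs_nonneg _).trans (hM 0)
  have hfam := hu.isGraphFamily hL (coe_lt_of_le_of_coe_lt htT (by linarith : t ≤ t + h))
  have hfamh := hu.isGraphFamily_shift hL htT hh
  rw [add_sub_cancel_right] at hfamh
  have hmem : t ∈ Set.Icc 0 t := ⟨ht, le_rfl⟩
  have hz : ∀ τ, 0 ≤ τ → τ ≤ t + h → ∀ y, |u τ y - u 0 y| ≤ M * (t + h) := fun τ hτ hτ' y =>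
    (hu.abs_sub_zero_le hs0 hs1 hT hL hM hτ (coe_lt_of_le_of_coe_lt htT hτ') y).trans (by gcongr)
  have hh0 : ∀ y, |u (0 + h) y - u 0 y| ≤ M * h := fun y => by
    rw [zero_add]
    exact hu.abs_sub_zero_le hs0 hs1 hT hL hM hh (coe_lt_of_le_of_coe_lt htT (by linarith)) y
  have hbdd : ∀ τ ∈ Set.Icc 0 t, ∀ y, |u (τ + h) y - u τ y| ≤ 2 * (M * (t + h)) :=
    fun τ hτ y => by
      have h1 := abs_le.1 (hz (τ + h) (by linarith [hτ.1]) (by linarith [hτ.2]) y)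
      have h2 := abs_le.1 (hz τ hτ.1 (by linarith [hτ.2]) y)
      exact abs_le.2 ⟨by linarith [h1.1, h2.2], by linarith [h1.2, h2.1]⟩
  have hev : ∀ τ ∈ Set.Ioc 0 t, ∀ y, HasDerivAt (fun τ => u τ y)
      (-(areaFactor (u τ) y * graphCurvature s (u τ) y)) τ :=
    fun τ hτ => hu.evolution τ hτ.1 (coe_lt_of_le_of_coe_lt htT (by linarith [hτ.2]))
  have hevh : ∀ τ ∈ Set.Ioc 0 t, ∀ y, HasDerivAt (fun τ => u (τ + h) y)
      (-(areaFactor (u (τ + h)) y * graphCurvature s (u (τ + h)) y)) τ := fun τ hτ y =>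
    (hu.evolution (τ + h) (by linarith [hτ.1])
      (coe_lt_of_le_of_coe_lt htT (by linarith [hτ.2])) y).comp_add_const τ h
  have h1 := hfamh.le_add_of_subsolution (M₁ := 0) (M₂ := 0) (m := M * h) (K := 2 * (M * (t + h)))
    hs0 hs1 hfam
    (by linarith) (fun τ hτ y => ⟨_, hevh τ hτ y, by linarith⟩)
    (fun τ hτ y => ⟨_, hev τ hτ y, by linarith⟩)
    (fun τ hτ y => by linarith [le_of_abs_le (hbdd τ hτ y)])
    (fun y => by linarith [le_of_abs_le (hh0 y)]) hmem x
  have h2 := hfam.le_add_of_subsolution (M₁ := 0) (M₂ := 0) (m := M * h) (K := 2 * (M * (t + h)))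
    hs0 hs1 hfamh
    (by linarith) (fun τ hτ y => ⟨_, hev τ hτ y, by linarith⟩)
    (fun τ hτ y => ⟨_, hevh τ hτ y, by linarith⟩)
    (fun τ hτ y => by linarith [neg_le_of_abs_le (hbdd τ hτ y)])
    (fun y => by linarith [neg_le_of_abs_le (hh0 y)]) hmem x
  exact abs_le.2 ⟨by linarith, by linarith⟩

end Flow

theorem mainTheorem11 {d : ℕ} (s : ℝ) (hs0 : 0 < s) (hs1 : s < 1) (T : EReal) (hT : 0 < T)
    (u : ℝ → EuclideanSpace ℝ (Fin d) → ℝ) (hu : IsGraphicalFlow s T u)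
    (L : ℝ) (hL : ∀ t : ℝ, 0 ≤ t → (t : EReal) < T → ∀ x, ‖gradient (u t) x‖ ≤ L)
    (M : ℝ) (hM : ∀ x, |areaFactor (u 0) x * graphCurvature s (u 0) x| ≤ M) :
    ∀ t : ℝ, 0 ≤ t → (t : EReal) < T → ∀ x,
      |areaFactor (u t) x * graphCurvature s (u t) x| ≤ M := by
  intro t ht htT x
  rcases ht.eq_or_lt with rfl | htpos
  · exact hM x
  -- Backward difference quotients only involve times in `[0, t]`, and each is bounded by `M`.
  have hder := (hasDerivWithinAt_iff_tendsto_slope' (s := Set.Iio t) (by simp)).1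
    (hu.evolution t htpos htT x).hasDerivWithinAt
  have habs := hder.abs
  rw [abs_neg] at habs
  refine le_of_tendsto habs ?_
  filter_upwards [Ioo_mem_nhdsLT htpos] with τ hτ
  have h := hu.abs_sub_le hs0 hs1 hT hL hM (t := τ) (h := t - τ) hτ.1.le (by linarith [hτ.2])
    (by rwa [add_sub_cancel]) x
  rw [add_sub_cancel, abs_sub_comm] at h
  rw [slope_def_field, abs_div, abs_sub_comm τ t, abs_of_pos (sub_pos.2 hτ.2),
    div_le_iff₀ (sub_pos.2 hτ.2)]
  exact h
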